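/- Let $M$ be a first-order structure. A *definable set* is a subset of some finite Cartesian power $M^k$ ($k\ge 0$) that is first-order definable with parameters from $M$; a *definable bijection* is a bijection between (finite disjoint unions of) definable sets whose graph is definable. The classes $[A]$ of definable sets (and of their finite disjoint unions) up to definable bijection form a commutative semiring, with addition induced by disjoint union and multiplication induced by Cartesian product. The *Grothendieck ring* $K_0(M)$ is the ring of formal differences of this semiring, in which two classes $a,b$ become equal if and only if $a+c=b+c$ for some class $c$. **Theorem.** Let $n\ge 1$ be an integer, let $L=\{l_1,\dots,l_n\}$ be the language consisting of $n$ unary function symbols, and let $M$ be a non-empty $L$-structure such that 1. the map $M\to M^n$, $x\mapsto (l_1(x),\dots,l_n(x))$, is a bijection; 2. for every $L$-term $t(x)$ in one variable $x$ other than the variable $x$ itself (that is, for every composition $t$ of at least one of the functions $l_1,\dots,l_n$) and every $x\in M$, $t(x)\neq x$. Then $K_0(M)\cong \mathbb{Z}[X]/(X-X^n)$. More precisely, there is a ring isomorphism $\mathbb{Z}[X]/(X-X^n)\to K_0(M)$ that sends the class of $X$ to $[M]$. -/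

import Mathlib

namespace PairingK0

open FirstOrder Set

universe u v w

section DefinableSets

variable (L : FirstOrder.Language.{u, v}) (M : Type w) [L.Structure M]

/-- A subset of a finite Cartesian power of `M` that is definable with parameters from `M`. -/
structure DefSet where
  dim : ℕ
  carrier : Set (Fin dim → M)
  definable : (Set.univ : Set M).Definable L carrier

variable {L M}

/-- The Cartesian product `A × B ⊆ M ^ (k + m)` of `A ⊆ M ^ k` and `B ⊆ M ^ m`. -/
def DefSet.prod (A B : DefSet L M) : DefSet L M where
  dim := A.dim + B.dim
  carrier := {z | (fun i => z (Fin.castAdd B.dim i)) ∈ A.carrier ∧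
    (fun j => z (Fin.natAdd A.dim j)) ∈ B.carrier}
  definable :=
    (A.definable.preimage_comp (Fin.castAdd B.dim)).inter
      (B.definable.preimage_comp (Fin.natAdd A.dim))

variable (L M) in
/-- The cartesian power `M ^ k`, as a definable set. -/
def DefSet.pow (k : ℕ) : DefSet L M where
  dim := k
  carrier := Set.univ
  definable := Set.definable_univ

/-- The disjoint union of a family of definable sets. -/
abbrev Total {ι : Type} (F : ι → DefSet L M) : Type w := Σ i, (F i).carrier

/-- The part of the graph of a bijection between two disjoint unions that lies in the product of the
`i`-th piece of the source and the `j`-th piece of the target. -/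
def graph {ι κ : Type} {F : ι → DefSet L M} {G : κ → DefSet L M} (e : Total F ≃ Total G)
    (i : ι) (j : κ) : Set (Fin (F i).dim ⊕ Fin (G j).dim → M) :=
  {z | ∃ (hx : z ∘ Sum.inl ∈ (F i).carrier) (hy : z ∘ Sum.inr ∈ (G j).carrier),
    e ⟨i, ⟨_, hx⟩⟩ = ⟨j, ⟨_, hy⟩⟩}

/-- There is a definable bijection (a bijection with definable graph) between the disjoint unions
of two families of definable sets. -/
def DefEquiv {ι κ : Type} (F : ι → DefSet L M) (G : κ → DefSet L M) : Prop :=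
  ∃ e : Total F ≃ Total G, ∀ i j, (Set.univ : Set M).Definable L (graph e i j)

theorem DefEquiv.symm {ι κ : Type} {F : ι → DefSet L M} {G : κ → DefSet L M}
    (h : DefEquiv F G) : DefEquiv G F := by
  obtain ⟨e, he⟩ := h
  refine ⟨e.symm, fun j i => ?_⟩
  convert! (he i j).preimage_comp (Sum.swap : Fin (F i).dim ⊕ Fin (G j).dim → _) using 1
  ext z
  simp only [graph, Set.mem_preimage, Set.mem_ofPred_eq]
  constructor
  · rintro ⟨hx, hy, h⟩
    exact ⟨hy, hx, (e.symm_apply_eq.1 h).symm⟩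
  · rintro ⟨hx, hy, h⟩
    exact ⟨hy, hx, e.symm_apply_eq.2 h.symm⟩

theorem DefEquiv.trans {ι κ τ : Type} [Finite κ] {F : ι → DefSet L M} {G : κ → DefSet L M}
    {H : τ → DefSet L M} (h : DefEquiv F G) (h' : DefEquiv G H) : DefEquiv F H := by
  obtain ⟨e, he⟩ := h
  obtain ⟨e', he'⟩ := h'
  refine ⟨e.trans e', fun i k => ?_⟩
  have key : ∀ j, (Set.univ : Set M).Definable L
      {v : Fin (F i).dim ⊕ Fin (H k).dim → M | ∃ y : Fin (G j).dim → M, Sum.elim v y ∈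
        ((fun g : (Fin (F i).dim ⊕ Fin (H k).dim) ⊕ Fin (G j).dim → M =>
          g ∘ Sum.elim (Sum.inl ∘ Sum.inl) Sum.inr) ⁻¹' graph e i j) ∩
        ((fun g : (Fin (F i).dim ⊕ Fin (H k).dim) ⊕ Fin (G j).dim → M =>
          g ∘ Sum.elim Sum.inr (Sum.inl ∘ Sum.inr)) ⁻¹' graph e' j k)} := fun j =>
    (((he i j).preimage_comp _).inter ((he' j k).preimage_comp _)).exists_of_finite
  convert! Set.definable_iUnion_of_finite key using 1
  ext z
  simp only [Set.mem_iUnion, Set.mem_ofPred_eq, Set.mem_inter_iff, Set.mem_preimage, graph]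
  constructor
  · rintro ⟨hx, hz, h⟩
    rcases hy : e ⟨i, ⟨_, hx⟩⟩ with ⟨j, y, hyj⟩
    refine ⟨j, y, ⟨hx, hyj, hy⟩, ⟨hyj, hz, ?_⟩⟩
    rw [Equiv.trans_apply, hy] at h
    exact h
  · rintro ⟨j, y, ⟨hx, hy, h1⟩, ⟨hy', hz, h2⟩⟩
    refine ⟨hx, hz, ?_⟩
    rw [Equiv.trans_apply]
    exact (congrArg e' h1).trans h2

/-- Matching the pieces of two families by permutations of coordinates gives a definable
bijection. -/
theorem DefEquiv.of_pieces {ι κ : Type} {F : ι → DefSet L M} {G : κ → DefSet L M} (σ : ι ≃ κ)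
    (f : ∀ i, Fin (G (σ i)).dim ≃ Fin (F i).dim)
    (hf : ∀ i (x : Fin (F i).dim → M), x ∈ (F i).carrier ↔ x ∘ f i ∈ (G (σ i)).carrier) :
    DefEquiv F G := by
  classical
  let e : Total F ≃ Total G := Equiv.sigmaCongr σ fun i =>
    { toFun := fun x => ⟨x.1 ∘ f i, (hf i _).1 x.2⟩
      invFun := fun y => ⟨y.1 ∘ (f i).symm, (hf i _).2 (by
        convert! y.2 using 1
        ext; simp)⟩
      left_inv := fun x => by ext; simp
      right_inv := fun y => by ext; simp }
  have hgr : ∀ i j z, z ∈ graph e i j ↔ ∃ (hx : z ∘ Sum.inl ∈ (F i).carrier)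
      (hy : z ∘ Sum.inr ∈ (G j).carrier),
      (⟨σ i, ⟨(z ∘ Sum.inl) ∘ f i, (hf i _).1 hx⟩⟩ : Total G) = ⟨j, ⟨_, hy⟩⟩ :=
    fun i j z => Iff.rfl
  refine ⟨e, fun i j => ?_⟩
  by_cases hij : σ i = j
  · subst hij
    have h1 : (Set.univ : Set M).Definable L
        {z : Fin (F i).dim ⊕ Fin (G (σ i)).dim → M |
          ∀ c, z (Sum.inl (f i c)) = z (Sum.inr c)} := by
      rw [Set.ofPred_forall]
      exact Set.definable_iInter_of_finite fun c => by
        refine ⟨(FirstOrder.Language.Term.var (Sum.inl (f i c))).equal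
          (FirstOrder.Language.Term.var (Sum.inr c)), ?_⟩
        ext z
        simp
    have h2 := (F i).definable.preimage_comp
      (Sum.inl : _ → Fin (F i).dim ⊕ Fin (G (σ i)).dim)
    convert! h2.inter h1 using 1
    ext z
    rw [hgr]
    simp only [Set.mem_inter_iff, Set.mem_preimage, Set.mem_ofPred_eq]
    constructor
    · rintro ⟨hx, hy, h⟩
      refine ⟨hx, fun c => ?_⟩
      have := congrArg Subtype.val (eq_of_heq (Sigma.mk.inj h).2)
      exact congrFun this c
    · rintro ⟨hx, h⟩
      have hh : (z ∘ Sum.inl) ∘ f i = z ∘ Sum.inr := funext h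
      refine ⟨hx, hh ▸ (hf i _).1 hx, ?_⟩
      congr 2
  · convert! Set.definable_empty (M := M) (L := L) (A := Set.univ) using 1
    ext z
    rw [hgr]
    simp only [Set.mem_empty_iff_false, iff_false]
    rintro ⟨hx, hy, h⟩
    exact hij (congrArg Sigma.fst h)

theorem DefEquiv.refl {ι : Type} (F : ι → DefSet L M) : DefEquiv F F :=
  DefEquiv.of_pieces (Equiv.refl ι) (fun _ => Equiv.refl _) (fun _ _ => Iff.rfl)

theorem DefEquiv.reindex {ι κ : Type} (F : κ → DefSet L M) (σ : ι ≃ κ) :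
    DefEquiv (F ∘ σ) F :=
  DefEquiv.of_pieces σ (fun _ => Equiv.refl _) (fun _ _ => Iff.rfl)

theorem DefEquiv.sum_congr {ι ι' κ κ' : Type} {F : ι → DefSet L M} {F' : ι' → DefSet L M}
    {G : κ → DefSet L M} {G' : κ' → DefSet L M} (h : DefEquiv F F') (h' : DefEquiv G G') :
    DefEquiv (Sum.elim F G) (Sum.elim F' G') := by
  obtain ⟨e, he⟩ := h
  obtain ⟨e', he'⟩ := h'
  let E : Total (Sum.elim F G) ≃ Total (Sum.elim F' G') :=
    (Equiv.sumSigmaDistrib (fun i => ((Sum.elim F G) i).carrier)).trans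
      ((Equiv.sumCongr e e').trans
        (Equiv.sumSigmaDistrib (fun i => ((Sum.elim F' G') i).carrier)).symm)
  have hl : ∀ i (x : (F i).carrier), E ⟨Sum.inl i, x⟩ =
      ⟨Sum.inl (e ⟨i, x⟩).1, (e ⟨i, x⟩).2⟩ := fun _ _ => rfl
  have hr : ∀ i (x : (G i).carrier), E ⟨Sum.inr i, x⟩ =
      ⟨Sum.inr (e' ⟨i, x⟩).1, (e' ⟨i, x⟩).2⟩ := fun _ _ => rfl
  refine ⟨E, ?_⟩
  rintro (i | i) (j | j)
  · convert! he i j using 1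
    ext z
    constructor
    · rintro ⟨hx, hy, h⟩
      refine ⟨hx, hy, ?_⟩
      have h0 := (hl i ⟨_, hx⟩).symm.trans h
      rcases hc : e ⟨i, ⟨_, hx⟩⟩ with ⟨a, b⟩
      rw [hc] at h0
      obtain ⟨h1, h2⟩ := Sigma.mk.inj h0
      cases h1
      exact hc.trans (congrArg (Sigma.mk a) (eq_of_heq h2))
    · rintro ⟨hx, hy, h⟩
      refine ⟨hx, hy, ?_⟩
      have h0 := hl i ⟨_, hx⟩
      rw [h] at h0
      exact h0
  · convert! Set.definable_empty (M := M) (L := L) (A := Set.univ) using 1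
    ext z
    simp only [Set.mem_empty_iff_false, iff_false]
    rintro ⟨hx, hy, h⟩
    have h0 := congrArg Sigma.fst ((hl i ⟨_, hx⟩).symm.trans h)
    cases h0
  · convert! Set.definable_empty (M := M) (L := L) (A := Set.univ) using 1
    ext z
    simp only [Set.mem_empty_iff_false, iff_false]
    rintro ⟨hx, hy, h⟩
    have h0 := congrArg Sigma.fst ((hr i ⟨_, hx⟩).symm.trans h)
    cases h0
  · convert! he' i j using 1
    ext z
    constructor
    · rintro ⟨hx, hy, h⟩
      refine ⟨hx, hy, ?_⟩
      have h0 := (hr i ⟨_, hx⟩).symm.trans h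
      rcases hc : e' ⟨i, ⟨_, hx⟩⟩ with ⟨a, b⟩
      rw [hc] at h0
      obtain ⟨h1, h2⟩ := Sigma.mk.inj h0
      cases h1
      exact hc.trans (congrArg (Sigma.mk a) (eq_of_heq h2))
    · rintro ⟨hx, hy, h⟩
      refine ⟨hx, hy, ?_⟩
      have h0 := hr i ⟨_, hx⟩
      rw [h] at h0
      exact h0

/-- The family of all products of a piece of `F` and a piece of `G`. -/
def prodFam {ι κ : Type} (F : ι → DefSet L M) (G : κ → DefSet L M) : ι × κ → DefSet L M :=
  fun p => (F p.1).prod (G p.2)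

/-- The points of a product of two families are the pairs of points. -/
def prodFamEquiv {ι κ : Type} (F : ι → DefSet L M) (G : κ → DefSet L M) :
    Total (prodFam F G) ≃ Total F × Total G where
  toFun z := (⟨z.1.1, ⟨_, z.2.2.1⟩⟩, ⟨z.1.2, ⟨_, z.2.2.2⟩⟩)
  invFun p := ⟨(p.1.1, p.2.1), ⟨Fin.append p.1.2.1 p.2.2.1, by
    constructor
    · simp
    · simp⟩⟩
  left_inv := by
    rintro ⟨⟨i, j⟩, ⟨z, hz⟩⟩
    exact congrArg (Sigma.mk (i, j)) (Subtype.ext Fin.append_castAdd_natAdd)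
  right_inv := by
    rintro ⟨⟨i, x, hx⟩, ⟨j, y, hy⟩⟩
    simp

theorem DefEquiv.prod_congr {ι ι' κ κ' : Type} {F : ι → DefSet L M} {F' : ι' → DefSet L M}
    {G : κ → DefSet L M} {G' : κ' → DefSet L M} (h : DefEquiv F F') (h' : DefEquiv G G') :
    DefEquiv (prodFam F G) (prodFam F' G') := by
  obtain ⟨e, he⟩ := h
  obtain ⟨e', he'⟩ := h'
  refine ⟨(prodFamEquiv F G).trans ((Equiv.prodCongr e e').trans (prodFamEquiv F' G').symm), ?_⟩
  rintro ⟨i, j⟩ ⟨i', j'⟩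
  have h1 := (he i i').preimage_comp
    (Sum.map (Fin.castAdd (G j).dim) (Fin.castAdd (G' j').dim))
  have h2 := (he' j j').preimage_comp
    (Sum.map (Fin.natAdd (F i).dim) (Fin.natAdd (F' i').dim))
  convert! h1.inter h2 using 1
  ext z
  constructor
  · rintro ⟨hx, hy, h⟩
    have h0 := (Equiv.symm_apply_eq (prodFamEquiv F' G')).1 h
    exact ⟨⟨hx.1, hy.1, congrArg Prod.fst h0⟩, ⟨hx.2, hy.2, congrArg Prod.snd h0⟩⟩
  · rintro ⟨⟨hx, hy, h⟩, ⟨hx', hy', h'⟩⟩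
    exact ⟨⟨hx, hx'⟩, ⟨hy, hy'⟩, (Equiv.symm_apply_eq (prodFamEquiv F' G')).2 (Prod.ext h h')⟩

theorem DefEquiv.sum_comm {ι κ : Type} (F : ι → DefSet L M) (G : κ → DefSet L M) :
    DefEquiv (Sum.elim F G) (Sum.elim G F) :=
  DefEquiv.of_pieces (Equiv.sumComm ι κ)
    (by rintro (i | i) <;> exact Equiv.refl _) (by rintro (i | i) x <;> exact Iff.rfl)

theorem DefEquiv.sum_assoc {ι κ τ : Type} (F : ι → DefSet L M) (G : κ → DefSet L M)
    (H : τ → DefSet L M) :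
    DefEquiv (Sum.elim (Sum.elim F G) H) (Sum.elim F (Sum.elim G H)) :=
  DefEquiv.of_pieces (Equiv.sumAssoc ι κ τ)
    (by rintro ((i | i) | i) <;> exact Equiv.refl _)
    (by rintro ((i | i) | i) x <;> exact Iff.rfl)

theorem DefEquiv.empty_sum {ι κ : Type} [IsEmpty ι] (F : ι → DefSet L M) (G : κ → DefSet L M) :
    DefEquiv (Sum.elim F G) G :=
  (DefEquiv.of_pieces (Equiv.emptySum ι κ).symm (fun _ => Equiv.refl _)
    (fun _ _ => Iff.rfl)).symm

theorem DefEquiv.prod_comm {ι κ : Type} (F : ι → DefSet L M) (G : κ → DefSet L M) :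
    DefEquiv (prodFam F G) (prodFam G F) :=
  DefEquiv.of_pieces (Equiv.prodComm ι κ) (fun _ => finAddFlip) (by
    rintro ⟨i, j⟩ (x : Fin ((F i).dim + (G j).dim) → M)
    have h1 : (fun c => (x ∘ finAddFlip) (Fin.castAdd (F i).dim c)) =
        fun c => x (Fin.natAdd (F i).dim c) := by
      funext c
      simp
    have h2 : (fun c => (x ∘ finAddFlip) (Fin.natAdd (G j).dim c)) =
        fun c => x (Fin.castAdd (G j).dim c) := by
      funext c
      simp
    change (_ ∈ (F i).carrier ∧ _ ∈ (G j).carrier) ↔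
      ((fun c => (x ∘ finAddFlip) (Fin.castAdd (F i).dim c)) ∈ (G j).carrier ∧
        (fun c => (x ∘ finAddFlip) (Fin.natAdd (G j).dim c)) ∈ (F i).carrier)
    rw [h1, h2]
    exact and_comm)

theorem DefEquiv.prod_assoc {ι κ τ : Type} (F : ι → DefSet L M) (G : κ → DefSet L M)
    (H : τ → DefSet L M) :
    DefEquiv (prodFam (prodFam F G) H) (prodFam F (prodFam G H)) :=
  DefEquiv.of_pieces (Equiv.prodAssoc ι κ τ)
    (fun _ => finCongr (Nat.add_assoc _ _ _).symm) (by
    rintro ⟨⟨i, j⟩, k⟩ (x : Fin (((F i).dim + (G j).dim) + (H k).dim) → M)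
    let y : Fin ((F i).dim + ((G j).dim + (H k).dim)) → M :=
      x ∘ finCongr (Nat.add_assoc _ _ _).symm
    have h : (fun c => x (Fin.natAdd ((F i).dim + (G j).dim) c)) =
        fun c => y (Fin.natAdd (F i).dim (Fin.natAdd (G j).dim c)) := by
      funext c
      exact congrArg x (Fin.ext (Nat.add_assoc _ _ _))
    change (((fun c => y (Fin.castAdd ((G j).dim + (H k).dim) c)) ∈ (F i).carrier ∧
        (fun c => y (Fin.natAdd (F i).dim (Fin.castAdd (H k).dim c))) ∈ (G j).carrier) ∧
        (fun c => x (Fin.natAdd ((F i).dim + (G j).dim) c)) ∈ (H k).carrier) ↔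
      ((fun c => y (Fin.castAdd ((G j).dim + (H k).dim) c)) ∈ (F i).carrier ∧
        (fun c => y (Fin.natAdd (F i).dim (Fin.castAdd (H k).dim c))) ∈ (G j).carrier ∧
        (fun c => y (Fin.natAdd (F i).dim (Fin.natAdd (G j).dim c))) ∈ (H k).carrier)
    rw [h, and_assoc])

theorem DefEquiv.one_prod {ι κ : Type} [Unique ι] (G : κ → DefSet L M) :
    DefEquiv (prodFam (fun _ : ι => DefSet.pow L M 0) G) G :=
  DefEquiv.of_pieces (Equiv.uniqueProd κ ι)
    (fun _ => finCongr (Nat.zero_add _).symm) (by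
    rintro ⟨i, j⟩ (x : Fin (0 + (G j).dim) → M)
    have h : (fun c => x (Fin.natAdd 0 c)) = x ∘ finCongr (Nat.zero_add _).symm := by
      funext c
      exact congrArg x (Fin.ext (Nat.zero_add _))
    change (_ ∈ Set.univ ∧ (fun c => x (Fin.natAdd 0 c)) ∈ (G j).carrier) ↔
      x ∘ finCongr (Nat.zero_add _).symm ∈ (G j).carrier
    rw [h]
    simp)

theorem DefEquiv.prod_sum {ι κ τ : Type} (F : ι → DefSet L M) (G : κ → DefSet L M)
    (H : τ → DefSet L M) :
    DefEquiv (prodFam F (Sum.elim G H)) (Sum.elim (prodFam F G) (prodFam F H)) :=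
  DefEquiv.of_pieces (Equiv.prodSumDistrib ι κ τ)
    (by rintro ⟨i, j | j⟩ <;> exact Equiv.refl _)
    (by rintro ⟨i, j | j⟩ x <;> exact Iff.rfl)

theorem DefEquiv.of_isEmpty {ι κ : Type} [IsEmpty ι] [IsEmpty κ] (F : ι → DefSet L M)
    (G : κ → DefSet L M) : DefEquiv F G :=
  DefEquiv.of_pieces (Equiv.equivOfIsEmpty ι κ) isEmptyElim isEmptyElim

variable (L M) in
/-- A finite disjoint union of definable subsets of Cartesian powers of `M`. If `M` has at least two
elements, it is in definable bijection with a single definable subset of some power of `M`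
(see `DefUnion.exists_rel_single`), so that these objects up to definable bijection are
the definable sets up to definable bijection; allowing finite unions makes the disjoint union
of two objects literally available. -/
structure DefUnion where
  num : ℕ
  piece : Fin num → DefSet L M

namespace DefUnion

/-- A definable set as a disjoint union with one piece. -/
def single (A : DefSet L M) : DefUnion L M := ⟨1, fun _ => A⟩

/-- Disjoint union. -/
def add (a b : DefUnion L M) : DefUnion L M :=
  ⟨a.num + b.num, Sum.elim a.piece b.piece ∘ finSumFinEquiv.symm⟩

/-- Cartesian product. -/
def mul (a b : DefUnion L M) : DefUnion L M :=
  ⟨a.num * b.num, prodFam a.piece b.piece ∘ finProdFinEquiv.symm⟩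

variable (L M) in
/-- `A ∼ B` if there is a definable bijection between `A` and `B`. -/
def setoid : Setoid (DefUnion L M) where
  r a b := DefEquiv a.piece b.piece
  iseqv := ⟨fun a => .refl a.piece, .symm, .trans⟩

theorem add_equiv (a b : DefUnion L M) : DefEquiv (a.add b).piece (Sum.elim a.piece b.piece) :=
  DefEquiv.reindex _ _

theorem mul_equiv (a b : DefUnion L M) : DefEquiv (a.mul b).piece (prodFam a.piece b.piece) :=
  DefEquiv.reindex _ _

/-- In a structure with at least two elements, every finite disjoint union of definable sets is in
definable bijection with a definable subset of a single Cartesian power of the structure. -/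
theorem exists_rel_single [Nontrivial M] (a : DefUnion L M) :
    ∃ A : DefSet L M, DefEquiv a.piece (fun _ : Fin 1 => A) := by
  classical
  obtain ⟨p, q, hpq⟩ := exists_pair_ne M
  let N := Finset.univ.sup fun i => (a.piece i).dim
  have hN : ∀ i, (a.piece i).dim ≤ N := fun i =>
    Finset.le_sup (f := fun i => (a.piece i).dim) (Finset.mem_univ i)
  let φ : ∀ i, (Fin (a.piece i).dim → M) → Fin (N + a.num) → M := fun i x =>
    Fin.append (fun c : Fin N => if h : c.1 < (a.piece i).dim then x ⟨c.1, h⟩ else p)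
      (fun j => if j = i then q else p)
  have hφ : ∀ i j x y, φ i x = φ j y → i = j := by
    intro i j x y h
    have h1 := congrFun h (Fin.natAdd N i)
    simp only [φ, Fin.append_right, if_true] at h1
    by_contra hij
    rw [if_neg hij] at h1
    exact hpq h1.symm
  have hφ' : ∀ i x y, φ i x = φ i y → x = y := by
    intro i x y h
    funext c
    have h1 := congrFun h (Fin.castAdd a.num ⟨c.1, c.2.trans_le (hN i)⟩)
    simpa only [φ, Fin.append_left, c.2, dif_pos] using h1
  have hdef : ∀ i, (Set.univ : Set M).Definable L
      {v : Fin (N + a.num) ⊕ Fin (a.piece i).dim → M |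
        v ∘ Sum.inr ∈ (a.piece i).carrier ∧ v ∘ Sum.inl = φ i (v ∘ Sum.inr)} := by
    intro i
    refine ((a.piece i).definable.preimage_comp Sum.inr).inter ?_
    have : ∀ c, (Set.univ : Set M).Definable L
        {v : Fin (N + a.num) ⊕ Fin (a.piece i).dim → M |
          v (Sum.inl c) = φ i (v ∘ Sum.inr) c} := by
      intro c
      refine Set.DefinableFun.ofPred_eq (Set.DefinableFun.proj L) ?_
      refine Fin.addCases (fun c => ?_) (fun c => ?_) c
      · by_cases h : c.1 < (a.piece i).dim
        · simpa [φ, h] using Set.DefinableFun.proj L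
        · simpa [φ, h] using L.definableFun_const _ (Set.mem_univ p)
      · by_cases h : c = i
        · simpa [φ, h] using L.definableFun_const _ (Set.mem_univ q)
        · simpa [φ, h] using L.definableFun_const _ (Set.mem_univ p)
    have h := Set.definable_iInter_of_finite this
    rw [← Set.ofPred_forall] at h
    simpa only [funext_iff] using! h
  let A : DefSet L M :=
    { dim := N + a.num
      carrier := ⋃ i, {y | ∃ x, Sum.elim y x ∈
        {v : Fin (N + a.num) ⊕ Fin (a.piece i).dim → M |
          v ∘ Sum.inr ∈ (a.piece i).carrier ∧ v ∘ Sum.inl = φ i (v ∘ Sum.inr)}}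
      definable := Set.definable_iUnion_of_finite fun i => (hdef i).exists_of_finite }
  have hA : ∀ i x, x ∈ (a.piece i).carrier → φ i x ∈ A.carrier := fun i x hx =>
    Set.mem_iUnion.2 ⟨i, x, hx, rfl⟩
  let f : Total a.piece → Total (fun _ : Fin 1 => A) := fun z => ⟨0, φ z.1 z.2.1, hA _ _ z.2.2⟩
  have hf : Function.Bijective f := by
    constructor
    · rintro ⟨i, x, hx⟩ ⟨j, y, hy⟩ h
      have h1 : φ i x = φ j y := congrArg Subtype.val (eq_of_heq (Sigma.mk.inj h).2)
      obtain rfl := hφ _ _ _ _ h1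
      obtain rfl := hφ' _ _ _ h1
      rfl
    · rintro ⟨j, y, hy⟩
      obtain rfl : j = 0 := Subsingleton.elim _ _
      obtain ⟨i, x, hx, h⟩ := Set.mem_iUnion.1 hy
      exact ⟨⟨i, x, hx⟩, congrArg (Sigma.mk 0) (Subtype.ext h.symm)⟩
  refine ⟨A, Equiv.ofBijective f hf, fun i j => ?_⟩
  obtain rfl : j = 0 := Subsingleton.elim _ _
  convert! (hdef i).preimage_comp
    (Sum.swap : Fin (N + a.num) ⊕ Fin (a.piece i).dim → _) using 1
  ext z
  constructor
  · rintro ⟨hx, hy, h⟩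
    exact ⟨hx, (congrArg Subtype.val (eq_of_heq (Sigma.mk.inj h).2)).symm⟩
  · rintro ⟨hx, h⟩
    have h' : z ∘ Sum.inr = φ i (z ∘ Sum.inl) := h
    exact ⟨hx, h' ▸ hA i _ hx, congrArg (Sigma.mk 0) (Subtype.ext h'.symm)⟩

end DefUnion

variable (L M) in
/-- The Grothendieck semiring of `M`: definable sets up to definable bijection. -/
def K0Semiring : Type w := Quotient (DefUnion.setoid L M)

namespace K0Semiring

/-- The class of a finite disjoint union of definable sets. -/
def mk (a : DefUnion L M) : K0Semiring L M := Quotient.mk (DefUnion.setoid L M) a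

theorem mk_eq_mk (a b : DefUnion L M) : mk a = mk b ↔ DefEquiv a.piece b.piece :=
  Quotient.eq (r := DefUnion.setoid L M)

instance : Zero (K0Semiring L M) := ⟨mk ⟨0, Fin.elim0⟩⟩

instance : One (K0Semiring L M) := ⟨mk (.single (.pow L M 0))⟩

/-- Addition is induced by the disjoint union. -/
instance : Add (K0Semiring L M) := ⟨Quotient.map₂ DefUnion.add fun a a' h b b' h' =>
  ((a.add_equiv b).trans (h.sum_congr h')).trans (a'.add_equiv b').symm⟩

/-- Multiplication is induced by the Cartesian product. -/
instance : Mul (K0Semiring L M) := ⟨Quotient.map₂ DefUnion.mul fun a a' h b b' h' =>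
  ((a.mul_equiv b).trans (h.prod_congr h')).trans (a'.mul_equiv b').symm⟩

instance : CommSemiring (K0Semiring L M) where
  add_assoc := by
    rintro ⟨a⟩ ⟨b⟩ ⟨c⟩
    exact Quotient.sound <|
      ((((a.add b).add_equiv c).trans ((a.add_equiv b).sum_congr (.refl _))).trans
        (.sum_assoc _ _ _)).trans
        ((a.add_equiv (b.add c)).trans ((DefEquiv.refl _).sum_congr (b.add_equiv c))).symm
  zero_add := by
    rintro ⟨a⟩
    exact Quotient.sound ((DefUnion.add_equiv _ a).trans (.empty_sum _ _))
  add_zero := by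
    rintro ⟨a⟩
    exact Quotient.sound (((DefUnion.add_equiv a _).trans (.sum_comm _ _)).trans (.empty_sum _ _))
  add_comm := by
    rintro ⟨a⟩ ⟨b⟩
    exact Quotient.sound (((a.add_equiv b).trans (.sum_comm _ _)).trans (b.add_equiv a).symm)
  mul_assoc := by
    rintro ⟨a⟩ ⟨b⟩ ⟨c⟩
    exact Quotient.sound <|
      ((((a.mul b).mul_equiv c).trans ((a.mul_equiv b).prod_congr (.refl _))).trans
        (.prod_assoc _ _ _)).trans
        ((a.mul_equiv (b.mul c)).trans ((DefEquiv.refl _).prod_congr (b.mul_equiv c))).symm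
  mul_comm := by
    rintro ⟨a⟩ ⟨b⟩
    exact Quotient.sound (((a.mul_equiv b).trans (.prod_comm _ _)).trans (b.mul_equiv a).symm)
  one_mul := by
    rintro ⟨a⟩
    exact Quotient.sound ((DefUnion.mul_equiv _ a).trans (.one_prod (ι := Fin 1) _))
  mul_one := by
    rintro ⟨a⟩
    exact Quotient.sound
      (((DefUnion.mul_equiv a _).trans (.prod_comm _ _)).trans (.one_prod (ι := Fin 1) _))
  zero_mul := by
    rintro ⟨a⟩
    exact Quotient.sound ((DefUnion.mul_equiv _ a).trans
      (.of_isEmpty (ι := Fin 0 × Fin a.num) _ _))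
  mul_zero := by
    rintro ⟨a⟩
    exact Quotient.sound ((DefUnion.mul_equiv a _).trans
      (.of_isEmpty (ι := Fin a.num × Fin 0) _ _))
  left_distrib := by
    rintro ⟨a⟩ ⟨b⟩ ⟨c⟩
    exact Quotient.sound <|
      ((a.mul_equiv (b.add c)).trans ((DefEquiv.refl _).prod_congr (b.add_equiv c))).trans <|
        (DefEquiv.prod_sum _ _ _).trans
          (((a.mul b).add_equiv (a.mul c)).trans ((a.mul_equiv b).sum_congr (a.mul_equiv c))).symm
  right_distrib := by
    rintro ⟨a⟩ ⟨b⟩ ⟨c⟩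
    exact Quotient.sound <|
      ((((a.add b).mul_equiv c).trans (.prod_comm _ _)).trans
        ((DefEquiv.refl _).prod_congr (a.add_equiv b))).trans <|
        (DefEquiv.prod_sum _ _ _).trans
          (((a.mul c).add_equiv (b.mul c)).trans
            (((a.mul_equiv c).trans (.prod_comm _ _)).sum_congr
              ((b.mul_equiv c).trans (.prod_comm _ _)))).symm
  nsmul := nsmulRec

end K0Semiring

end DefinableSets

section RingCompletion

open Algebra

/-- The ring completion of a commutative semiring `S`: its elements are the formal differences
`a - b` with `a, b` in `S`, where `a - b = a' - b'` if and only if `a + b' + c = a' + b + c` for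
some `c` in `S`. Equivalently, it is the smallest ring containing the quotient of `S` by the
relation `∃ c, a + c = b + c`. -/
def RingCompletion (S : Type w) [CommSemiring S] : Type w := GrothendieckAddGroup S

namespace RingCompletion

variable {S : Type w} [CommSemiring S]

instance instAddCommGroup : AddCommGroup (RingCompletion S) :=
  inferInstanceAs (AddCommGroup (GrothendieckAddGroup S))

/-- The canonical additive map from a semiring to its ring completion. -/
noncomputable def of : S →+ RingCompletion S := GrothendieckAddGroup.of

theorem of_eq_of_iff (a b : S) : of a = of b ↔ ∃ c, a + c = b + c := by
  have h : (of a = of b) ↔ _ :=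
    (AddLocalization.addMonoidOf (⊤ : AddSubmonoid S)).eq_iff_exists (x := a) (y := b)
  rw [h]
  constructor
  · rintro ⟨c, hc⟩
    exact ⟨c, by simpa [add_comm] using hc⟩
  · rintro ⟨c, hc⟩
    exact ⟨⟨c, AddSubmonoid.mem_top c⟩, by simpa [add_comm] using hc⟩

theorem exists_sub (x : RingCompletion S) : ∃ a b : S, x = of a - of b := by
  obtain ⟨⟨a, b⟩, h⟩ := (AddLocalization.addMonoidOf (⊤ : AddSubmonoid S)).surj x
  exact ⟨a, b, eq_sub_of_add_eq h⟩

theorem hom_ext {G : Type*} [AddCommGroup G] {f g : RingCompletion S →+ G}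
    (h : ∀ a, f (of a) = g (of a)) : f = g := by
  ext x
  obtain ⟨a, b, rfl⟩ := exists_sub x
  simp [h]

/-- The extension of an additive map to the ring completion. -/
noncomputable def liftAdd {G : Type*} [AddCommGroup G] (f : S →+ G) : RingCompletion S →+ G :=
  GrothendieckAddGroup.lift f

theorem liftAdd_of {G : Type*} [AddCommGroup G] (f : S →+ G) (a : S) :
    liftAdd f (of a) = f a :=
  DFunLike.congr_fun (GrothendieckAddGroup.lift.symm_apply_apply f) a

/-- The biadditive extension of the multiplication of `S` to its ring completion. -/
noncomputable def mulHom : RingCompletion S →+ RingCompletion S →+ RingCompletion S :=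
  liftAdd
    { toFun := fun a => liftAdd (of.comp (AddMonoidHom.mulLeft a))
      map_zero' := hom_ext fun b => by simp [liftAdd_of]
      map_add' := fun a a' => hom_ext fun b => by simp [liftAdd_of, add_mul] }

noncomputable instance : Mul (RingCompletion S) := ⟨fun x y => mulHom x y⟩

noncomputable instance : One (RingCompletion S) := ⟨of 1⟩

theorem mul_def (x y : RingCompletion S) : x * y = mulHom x y := rfl

theorem of_mul (a b : S) : (of (a * b) : RingCompletion S) = of a * of b := by
  simp [mul_def, mulHom, liftAdd_of]

theorem add_mul_aux (x y z : RingCompletion S) : (x + y) * z = x * z + y * z := by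
  simp [mul_def]

theorem mul_add_aux (x y z : RingCompletion S) : x * (y + z) = x * y + x * z := by
  simp [mul_def]

theorem sub_mul_aux (x y z : RingCompletion S) : (x - y) * z = x * z - y * z := by
  simp [mul_def]

theorem mul_sub_aux (x y z : RingCompletion S) : x * (y - z) = x * y - x * z := by
  simp [mul_def]

theorem mul_comm_aux (x y : RingCompletion S) : x * y = y * x := by
  obtain ⟨a, b, rfl⟩ := exists_sub x
  obtain ⟨c, d, rfl⟩ := exists_sub y
  simp only [sub_mul_aux, mul_sub_aux, ← of_mul]
  rw [mul_comm c a, mul_comm c b, mul_comm d a, mul_comm d b]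
  abel

theorem one_mul_aux (x : RingCompletion S) : 1 * x = x := by
  obtain ⟨a, b, rfl⟩ := exists_sub x
  change of 1 * (of a - of b) = of a - of b
  simp only [mul_sub_aux, ← of_mul, one_mul]

/-- The ring structure on the ring completion, extending that of `S`. -/
noncomputable instance : CommRing (RingCompletion S) where
  __ := instAddCommGroup (S := S)
  mul_assoc x y z := by
    obtain ⟨a, b, rfl⟩ := exists_sub x
    obtain ⟨c, d, rfl⟩ := exists_sub y
    obtain ⟨e, f, rfl⟩ := exists_sub z
    simp only [sub_mul_aux, mul_sub_aux, ← of_mul, mul_assoc]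
  one_mul := one_mul_aux
  mul_one x := by rw [mul_comm_aux, one_mul_aux]
  left_distrib := mul_add_aux
  right_distrib := add_mul_aux
  zero_mul x := by simp [mul_def]
  mul_zero x := by simp [mul_def]
  mul_comm := mul_comm_aux

/-- The canonical semiring homomorphism from a semiring to its ring completion. -/
noncomputable def ofHom : S →+* RingCompletion S :=
  { (of : S →+ RingCompletion S) with
    map_one' := rfl
    map_mul' := of_mul }

end RingCompletion

end RingCompletion

section GrothendieckRing

variable (L : FirstOrder.Language.{u, v}) (M : Type w) [L.Structure M]

/-- The Grothendieck ring `K₀(M)` of the structure `M`. -/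
abbrev K0 : Type w := RingCompletion (K0Semiring L M)

variable {L M}

/-- The class `[A]` of a definable set `A` in the Grothendieck ring. -/
noncomputable def K0.cls (A : DefSet L M) : K0 L M :=
  RingCompletion.of (K0Semiring.mk (DefUnion.single A))

end GrothendieckRing

section UnaryLanguage

/-- The function symbols `l₁, …, lₙ`, all unary. -/
inductive UnaryFunc (n : ℕ) : ℕ → Type
  | l (i : Fin n) : UnaryFunc n 1

/-- The language consisting of `n` unary function symbols `l₁, …, lₙ`. -/
def unaryLang (n : ℕ) : FirstOrder.Language.{0, 0} where
  Functions := UnaryFunc n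
  Relations := fun _ => Empty

/-- The interpretation of the symbol `lᵢ` in a structure `M`, as a map from `M` to `M`. -/
def op {n : ℕ} {M : Type w} [(unaryLang n).Structure M] (i : Fin n) (x : M) : M :=
  FirstOrder.Language.Structure.funMap (L := unaryLang n) (UnaryFunc.l i) ![x]

end UnaryLanguage

end PairingK0

/-! Package the `l_i` into one bijection `f : M ≃ (Fin n → M)` and work with trees: terms in
variables and parameters whose inner nodes apply the inverse of `f`. The components of `f` undo
nodes, so equations between trees are solved by unification. An equation between two nodes splits
into `n` equations between children. An equation `v = t` eliminates `v` when `v` does not occur in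
`t`; when `v` occurs in `t ≠ v`, acyclicity leaves no solution. So the solution set of a finite
system is empty or a cell, an injective tree image of some `M ^ k` (`solvable_solutions`). These
sets play the role of closed sets.

Closed sets behave irreducibly. A tree map into `M ^ V` is either onto or satisfies a nontrivial
word relation (`polyMap_trichotomy`), while points avoiding all short relations exist
(`exists_generic`). Hence a cell covered by finitely many closed sets lies in one of them. Moreover,
which case occurs does not depend on the values of the parameters, so the fibres of a family behave
uniformly. This gives stability of constructible sets under projection (`Constructible.image_comp`)
and so quantifier elimination (`Definable.constructible`).

The dimension `k` of a cell is not unique, since `M` is also `M ^ n`, but `r ^ k` is whenever `r ^ n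
= r` (`IsCell.pow_eq`). Irreducibility makes the indicators of cells linearly independent, so the
assignment of `r ^ k` to a cell extends to an additive Euler characteristic. It is invariant under
injective projections, hence under definable bijections (`DefEquiv.sum_euler_eq`), and descends to
the Grothendieck ring.

Finally, `m = [M]` satisfies `m ^ n = m`, whence a ring map from `ℤ[X]/(X - X ^ n)`. It is onto
because definable sets are built from cells by disjoint unions and differences, and a cell of
dimension `k` has class `m ^ k`. It is injective because the Euler characteristic with values in
`ℤ[X]/(X - X ^ n)` and `r` the class of `X` is an additive left inverse. -/

namespace PairingK0

open Set Function

universe u v w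

/-! ### Trees and words -/

/-- Finite `n`-ary trees with leaves labelled by `A`. -/
inductive Tree (n : ℕ) (A : Type u) : Type u
  | leaf (a : A) : Tree n A
  | node (t : Fin n → Tree n A) : Tree n A

namespace Tree

variable {n : ℕ} {A : Type u} {B : Type v} {M : Type w}

/-- Substitution of trees for the leaves of a tree. -/
def bind (σ : A → Tree n B) : Tree n A → Tree n B
  | leaf a => σ a
  | node t => node fun i => (t i).bind σ

/-- The label `a` occurs in a tree. -/
def Mem (a : A) : Tree n A → Prop
  | leaf b => a = b
  | node t => ∃ i, (t i).Mem a

/-- The number of inner nodes of a tree. -/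
def nodes : Tree n A → ℕ
  | leaf _ => 0
  | node t => 1 + ∑ i, (t i).nodes

/-- The value of a tree, its inner nodes being interpreted by the inverse of `f`. -/
def eval (f : M ≃ (Fin n → M)) (z : A → M) : Tree n A → M
  | leaf a => z a
  | node t => f.symm fun i => (t i).eval f z

theorem eval_bind (f : M ≃ (Fin n → M)) (σ : A → Tree n B) (z : B → M) (t : Tree n A) :
    (t.bind σ).eval f z = t.eval f fun a => (σ a).eval f z := by
  induction t with
  | leaf a => rfl
  | node t ih => simp only [bind, eval, ih]

theorem eval_congr (f : M ≃ (Fin n → M)) {z z' : A → M} {t : Tree n A}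
    (h : ∀ a, t.Mem a → z a = z' a) : t.eval f z = t.eval f z' := by
  induction t with
  | leaf a => exact h a rfl
  | node t ih =>
    simp only [eval]
    congr 1
    funext i
    exact ih i fun a ha => h a ⟨i, ha⟩

end Tree

/-- The composition of the components of `f` along a word. -/
def word {n : ℕ} {M : Type w} (f : M ≃ (Fin n → M)) : List (Fin n) → M → M
  | [], x => x
  | a :: l, x => word f l (f x a)

/-- A bijection between `M` and `M ^ n` none of whose component words has a fixed point. -/
structure AcyclicPairing (n : ℕ) (M : Type w) where
  toEquiv : M ≃ (Fin n → M)
  pos : 0 < n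
  word_ne : ∀ l ≠ [], ∀ x, word toEquiv l x ≠ x

/-- The word is the path from the root to the leaf: each component of `f` undoes one node. The
clause on the empty path separates the trivial equation `a = a` from the cyclic ones. -/
theorem Tree.exists_word_of_mem {n : ℕ} {A : Type u} {M : Type w} (f : M ≃ (Fin n → M)) {a : A}
    {t : Tree n A} (h : t.Mem a) :
    ∃ l, (∀ z : A → M, word f l (t.eval f z) = z a) ∧ (l = [] → t = leaf a) := by
  induction t with
  | leaf b =>
    obtain rfl : a = b := h
    exact ⟨[], fun z => rfl, fun _ => rfl⟩
  | node t ih =>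
    obtain ⟨i, hi⟩ := h
    obtain ⟨l, hl, -⟩ := ih i hi
    exact ⟨i :: l, fun z => by simpa [word, eval] using hl z, by simp⟩

/-! ### Tree maps and unification -/

section PolyMap

variable {n : ℕ} {M : Type w} {P : Type v} {ι V U : Type}

/-- The map `M ^ V → M ^ ι` given by trees with leaves in `V` and parameters in `P`. -/
def polyMap (f : M ≃ (Fin n → M)) (e : P → M) (σ : ι → Tree n (V ⊕ P)) (z : V → M) : ι → M :=
  fun i => (σ i).eval f (Sum.elim z e)

/-- The composition of families of trees. -/
def polyComp (σ : ι → Tree n (V ⊕ M)) (τ : V → Tree n (U ⊕ M)) : ι → Tree n (U ⊕ M) :=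
  fun i => (σ i).bind (Sum.elim τ fun c => .leaf (.inr c))

theorem eval_polyComp (f : M ≃ (Fin n → M)) (t : Tree n (V ⊕ M)) (τ : V → Tree n (U ⊕ M))
    (z : U → M) :
    (t.bind (Sum.elim τ fun c => .leaf (.inr c))).eval f (Sum.elim z id) =
      t.eval f (Sum.elim (polyMap f id τ z) id) := by
  rw [Tree.eval_bind]
  congr 1
  funext a
  rcases a with a | a <;> rfl

theorem polyMap_polyComp (f : M ≃ (Fin n → M)) (σ : ι → Tree n (V ⊕ M))
    (τ : V → Tree n (U ⊕ M)) (z : U → M) :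
    polyMap f id (polyComp σ τ) z = polyMap f id σ (polyMap f id τ z) :=
  funext fun i => eval_polyComp f (σ i) τ z

/-- Renaming of variables. -/
def renameVar (g : V → U) : Tree n (V ⊕ P) → Tree n (U ⊕ P) :=
  Tree.bind fun a => .leaf (Sum.map g id a)

theorem eval_renameVar (f : M ≃ (Fin n → M)) (e : P → M) (g : V → U) (t : Tree n (V ⊕ P))
    (z : U → M) :
    (renameVar g t).eval f (Sum.elim z e) = t.eval f (Sum.elim (z ∘ g) e) := by
  rw [renameVar, Tree.eval_bind]
  congr 1
  funext a
  rcases a with a | a <;> rfl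

/-- The solution set of a system of equations between trees is empty, everything, or parametrized
by fewer variables. -/
def Solvable (f : M ≃ (Fin n → M)) [Fintype V] (S : Set (V → M)) : Prop :=
  S = ∅ ∨ S = univ ∨ ∃ (U : Type) (_ : Fintype U) (σ : V → Tree n (U ⊕ M)),
    Fintype.card U < Fintype.card V ∧ Injective (polyMap f id σ) ∧ range (polyMap f id σ) = S

/-- The solution set of a system of equations. -/
def solutions (f : M ≃ (Fin n → M)) (E : List (Tree n (V ⊕ M) × Tree n (V ⊕ M))) :
    Set (V → M) :=
  {z | ∀ e ∈ E, e.1.eval f (Sum.elim z id) = e.2.eval f (Sum.elim z id)}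

theorem polyMap_mem_solutions (f : M ≃ (Fin n → M)) (σ : V → Tree n (U ⊕ M)) (z : U → M)
    (E : List (Tree n (V ⊕ M) × Tree n (V ⊕ M))) :
    polyMap f id σ z ∈ solutions f E ↔ z ∈ solutions f (E.map (Prod.map
      (Tree.bind (Sum.elim σ fun c => .leaf (.inr c)))
      (Tree.bind (Sum.elim σ fun c => .leaf (.inr c))))) := by
  simp only [solutions, Set.mem_ofPred_eq, List.forall_mem_map, Prod.map, eval_polyComp]

theorem Solvable.image {f : M ≃ (Fin n → M)} [Fintype V] [Fintype U] {S : Set (U → M)}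
    (h : Solvable f S) {σ : V → Tree n (U ⊕ M)} (hσ : Injective (polyMap f id σ))
    (hc : Fintype.card U < Fintype.card V) : Solvable f (polyMap f id σ '' S) := by
  rcases h with rfl | rfl | ⟨W, _, τ, hW, hτ, rfl⟩
  · exact Or.inl (image_empty _)
  · exact Or.inr (Or.inr ⟨U, _, σ, hc, hσ, image_univ.symm⟩)
  · have h : polyMap f id (polyComp σ τ) = polyMap f id σ ∘ polyMap f id τ :=
      funext (polyMap_polyComp f σ τ)
    exact Or.inr (Or.inr ⟨W, _, polyComp σ τ, hW.trans hc, h ▸ hσ.comp hτ,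
      by rw [h, range_comp]⟩)

/-- Solving one equation nontrivially lowers the number of variables; substituting the
parametrization into the other equations leaves a system covered by `ih`. -/
theorem solvable_of_forall_singleton (f : M ≃ (Fin n → M)) [Fintype V]
    (ih : ∀ (U : Type) [Fintype U], Fintype.card U < Fintype.card V →
      ∀ E : List (Tree n (U ⊕ M) × Tree n (U ⊕ M)), Solvable f (solutions f E))
    (E : List (Tree n (V ⊕ M) × Tree n (V ⊕ M)))
    (hE : ∀ e ∈ E, Solvable f (solutions f [e])) : Solvable f (solutions f E) := by
  induction E with
  | nil => exact Or.inr (Or.inl (by simp [solutions]))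
  | cons e E ihE =>
    have h : solutions f (e :: E) = solutions f [e] ∩ solutions f E := by
      ext z
      simp [solutions]
    rcases hE e (by simp) with h0 | h0 | ⟨U, _, σ, hU, hσ, h0⟩
    · exact Or.inl (by rw [h, h0, empty_inter])
    · rw [h, h0, univ_inter]
      exact ihE fun e he => hE e (by simp [he])
    · have := (ih U hU _).image hσ hU (S := solutions f (E.map (Prod.map
        (Tree.bind (Sum.elim σ fun c => .leaf (.inr c)))
        (Tree.bind (Sum.elim σ fun c => .leaf (.inr c))))))
      convert! this using 1
      rw [h, ← h0]
      ext z
      constructor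
      · rintro ⟨⟨x, rfl⟩, hx⟩
        exact ⟨x, (polyMap_mem_solutions f σ x E).1 hx, rfl⟩
      · rintro ⟨x, hx, rfl⟩
        exact ⟨⟨x, rfl⟩, (polyMap_mem_solutions f σ x E).2 hx⟩

theorem solutions_singleton_swap (f : M ≃ (Fin n → M)) (s t : Tree n (V ⊕ M)) :
    solutions f [(s, t)] = solutions f [(t, s)] := by
  ext z
  simp [solutions, eq_comm]

/-- Occurs check: if `v` lies in `t` at a nonempty path, a solution would be a fixed point of that
word. If `v` is absent from `t`, the solution set is a graph over the other variables. -/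
theorem solvable_var_eq (f : AcyclicPairing n M) [Nonempty M] [Fintype V] (v : V)
    (t : Tree n (V ⊕ M)) : Solvable f.toEquiv (solutions f.toEquiv [(.leaf (.inl v), t)]) := by
  classical
  by_cases ht : t.Mem (.inl v)
  · obtain ⟨l, hl, hl'⟩ := Tree.exists_word_of_mem f.toEquiv ht
    by_cases h0 : l = []
    · rw [hl' h0]
      exact Or.inr (Or.inl (by simp [solutions]))
    · refine Or.inl (eq_empty_of_forall_notMem fun z hz => f.word_ne l h0 (z v) ?_)
      have h1 : z v = t.eval f.toEquiv (Sum.elim z id) := by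
        simpa [solutions, Tree.eval] using hz
      conv_lhs => rw [h1]
      exact hl _
  -- The arbitrary constant replaces `v`, which does not occur in `t`, so it never affects a value.
  · let g : V ⊕ M → {u : V // u ≠ v} ⊕ M := Sum.elim
      (fun u => if h : u ≠ v then .inl ⟨u, h⟩ else .inr (Classical.arbitrary M)) .inr
    let t' : Tree n ({u : V // u ≠ v} ⊕ M) := t.bind fun a => .leaf (g a)
    let σ : V → Tree n ({u : V // u ≠ v} ⊕ M) := fun u =>
      if h : u ≠ v then .leaf (.inl ⟨u, h⟩) else t'
    have ht' : ∀ z : V → M, t'.eval f.toEquiv (Sum.elim (fun u => z u.1) id) =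
        t.eval f.toEquiv (Sum.elim z id) := by
      intro z
      rw [Tree.eval_bind]
      refine Tree.eval_congr _ fun a ha => ?_
      rcases a with u | c
      · have hu : u ≠ v := fun h => ht (h ▸ ha)
        simp [g, hu, Tree.eval]
      · rfl
    have hσ : ∀ z u (hu : u ≠ v), polyMap f.toEquiv id σ z u = z ⟨u, hu⟩ := by
      intro z u hu
      simp [polyMap, σ, hu, Tree.eval]
    have hσv : ∀ z, polyMap f.toEquiv id σ z v = t'.eval f.toEquiv (Sum.elim z id) := by
      intro z
      simp [polyMap, σ]
    refine Or.inr (Or.inr ⟨_, inferInstance, σ, Fintype.card_subtype_lt (x := v) (by simp),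
      ?_, ?_⟩)
    · intro z z' h
      funext u
      rw [← hσ z u.1 u.2, h, hσ z' u.1 u.2]
    · ext z
      constructor
      · rintro ⟨x, rfl⟩
        simp only [solutions, List.mem_singleton, forall_eq, Set.mem_ofPred_eq, Tree.eval,
          Sum.elim_inl]
        rw [hσv, ← ht']
        congr 2
        funext u
        exact (hσ x u.1 u.2).symm
      · intro hz
        have h1 : z v = t.eval f.toEquiv (Sum.elim z id) := by
          simpa [solutions, Tree.eval] using hz
        refine ⟨fun u => z u.1, funext fun u => ?_⟩
        by_cases hu : u = v
        · subst hu
          rw [hσv, ht', h1]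
        · rw [hσ _ u hu]

theorem solutions_node (f : M ≃ (Fin n → M)) (s : Fin n → Tree n (V ⊕ M))
    (t : Tree n (V ⊕ M)) (t' : Fin n → Tree n (V ⊕ M))
    (h : ∀ z i, (t' i).eval f (Sum.elim z id) = f (t.eval f (Sum.elim z id)) i) :
    solutions f [(.node s, t)] = solutions f (List.ofFn fun i => (s i, t' i)) := by
  ext z
  simp only [solutions, List.mem_singleton, forall_eq, Set.mem_ofPred_eq, List.forall_mem_ofFn_iff,
    Tree.eval, h, Equiv.symm_apply_eq, funext_iff]

/-- Structural descent on trees. A parameter `c` facing a node is expanded into its components `f c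
i`, so the descent follows the other tree and needs `hconst` for all constants at once. -/
theorem solvable_singleton (f : AcyclicPairing n M) [Nonempty M] [Fintype V]
    (ih : ∀ (U : Type) [Fintype U], Fintype.card U < Fintype.card V →
      ∀ E : List (Tree n (U ⊕ M) × Tree n (U ⊕ M)), Solvable f.toEquiv (solutions f.toEquiv E))
    (s t : Tree n (V ⊕ M)) : Solvable f.toEquiv (solutions f.toEquiv [(s, t)]) := by
  have hconst : ∀ (t : Tree n (V ⊕ M)) (c : M),
      Solvable f.toEquiv (solutions f.toEquiv [(t, .leaf (.inr c))]) := by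
    intro t
    induction t with
    | leaf a =>
      intro c
      rcases a with v | b
      · exact solvable_var_eq f v _
      · by_cases h : b = c
        · exact Or.inr (Or.inl (by simp [solutions, Tree.eval, h]))
        · exact Or.inl (by simp [solutions, Tree.eval, h])
    | node t iht =>
      intro c
      rw [solutions_node f.toEquiv t _ (fun i => .leaf (.inr (f.toEquiv c i)))
        fun z i => by simp [Tree.eval]]
      refine solvable_of_forall_singleton _ ih _ ?_
      rw [List.forall_mem_ofFn_iff]
      exact fun i => iht i _
  induction s generalizing t with
  | leaf a =>
    rcases a with v | c
    · exact solvable_var_eq f v t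
    · rw [solutions_singleton_swap]
      exact hconst t c
  | node s ihs =>
    rcases t with (v | c) | t
    · rw [solutions_singleton_swap]
      exact solvable_var_eq f v _
    · exact hconst _ c
    · rw [solutions_node f.toEquiv s _ t fun z i => by simp [Tree.eval]]
      refine solvable_of_forall_singleton _ ih _ ?_
      rw [List.forall_mem_ofFn_iff]
      exact fun i => ihs i _

theorem solvable_solutions (f : AcyclicPairing n M) [Nonempty M] [Fintype V]
    (E : List (Tree n (V ⊕ M) × Tree n (V ⊕ M))) : Solvable f.toEquiv (solutions f.toEquiv E) := by
  induction hN : Fintype.card V using Nat.strong_induction_on generalizing V with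
  | _ N ih =>
    subst hN
    have ih' : ∀ (U : Type) [Fintype U], Fintype.card U < Fintype.card V →
        ∀ E : List (Tree n (U ⊕ M) × Tree n (U ⊕ M)),
          Solvable f.toEquiv (solutions f.toEquiv E) := fun U _ hU E => ih _ hU E rfl
    exact solvable_of_forall_singleton _ ih' E fun e _ => solvable_singleton f ih' e.1 e.2

end PolyMap

/-! ### Cells and closed sets -/

section Cells

variable {n : ℕ} {M : Type w} {ι κ V U : Type}

/-- A subset of `M ^ ι` that is the image of an injective map `M ^ k → M ^ ι` given by trees. -/
def IsCell (f : M ≃ (Fin n → M)) (k : ℕ) (S : Set (ι → M)) : Prop :=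
  ∃ (V : Type) (_ : Fintype V) (σ : ι → Tree n (V ⊕ M)),
    Fintype.card V = k ∧ Injective (polyMap f id σ) ∧ range (polyMap f id σ) = S

/-- A set that is empty or a cell. -/
def IsClosedSet (f : M ≃ (Fin n → M)) (S : Set (ι → M)) : Prop := S = ∅ ∨ ∃ k, IsCell f k S

theorem isCell_range (f : M ≃ (Fin n → M)) [Fintype V] {σ : ι → Tree n (V ⊕ M)}
    (h : Injective (polyMap f id σ)) : IsCell f (Fintype.card V) (range (polyMap f id σ)) :=
  ⟨V, _, σ, rfl, h, rfl⟩

theorem isCell_univ (f : M ≃ (Fin n → M)) [Fintype ι] :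
    IsCell f (Fintype.card ι) (univ : Set (ι → M)) := by
  refine ⟨ι, _, fun i => .leaf (.inl i), rfl, fun z z' h => h, ?_⟩
  exact eq_univ_of_forall fun z => ⟨z, rfl⟩

theorem IsCell.exists_fin {f : M ≃ (Fin n → M)} {k : ℕ} {B : Set (ι → M)}
    (h : IsCell f k B) : ∃ σ : ι → Tree n (Fin k ⊕ M),
      Injective (polyMap f id σ) ∧ range (polyMap f id σ) = B := by
  obtain ⟨V, _, σ, hk, hσ, rfl⟩ := h
  let e := Fintype.equivFinOfCardEq hk
  have hmap : polyMap f id (fun i => renameVar e (σ i)) =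
      polyMap f id σ ∘ fun z : Fin k → M => z ∘ e := by
    funext z i
    exact eval_renameVar f id e (σ i) z
  refine ⟨_, hmap ▸ hσ.comp e.surjective.injective_comp_right, ?_⟩
  have hs : Surjective fun z : Fin k → M => z ∘ e := fun z =>
    ⟨z ∘ e.symm, funext fun v => congrArg z (e.symm_apply_apply v)⟩
  rw [hmap, range_comp, hs.range_eq, image_univ]

theorem IsCell.image {f : M ≃ (Fin n → M)} {k : ℕ} {S : Set (V → M)} (h : IsCell f k S)
    {σ : ι → Tree n (V ⊕ M)} (hσ : Injective (polyMap f id σ)) :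
    IsCell f k (polyMap f id σ '' S) := by
  obtain ⟨U, _, τ, rfl, hτ, rfl⟩ := h
  have h : polyMap f id (polyComp σ τ) = polyMap f id σ ∘ polyMap f id τ :=
    funext (polyMap_polyComp f σ τ)
  exact ⟨U, _, polyComp σ τ, rfl, h ▸ hσ.comp hτ, by rw [h, range_comp]⟩

theorem IsClosedSet.image {f : M ≃ (Fin n → M)} {S : Set (V → M)} (h : IsClosedSet f S)
    {σ : ι → Tree n (V ⊕ M)} (hσ : Injective (polyMap f id σ)) :
    IsClosedSet f (polyMap f id σ '' S) := by
  rcases h with rfl | ⟨k, h⟩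
  · exact Or.inl (image_empty _)
  · exact Or.inr ⟨k, h.image hσ⟩

theorem isClosedSet_univ (f : M ≃ (Fin n → M)) [Finite ι] :
    IsClosedSet f (univ : Set (ι → M)) := by
  cases nonempty_fintype ι
  exact Or.inr ⟨_, isCell_univ f⟩

theorem isClosedSet_solutions (f : AcyclicPairing n M) [Nonempty M] [Finite V]
    (E : List (Tree n (V ⊕ M) × Tree n (V ⊕ M))) :
    IsClosedSet f.toEquiv (solutions f.toEquiv E) := by
  cases nonempty_fintype V
  rcases solvable_solutions f E with h | h | ⟨U, _, σ, -, hσ, h⟩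
  · exact Or.inl h
  · exact h ▸ isClosedSet_univ _
  · exact h ▸ Or.inr ⟨_, isCell_range _ hσ⟩

/-- The fibre product of two maps given by trees. -/
theorem exists_fiberProduct (f : AcyclicPairing n M) [Nonempty M] [Finite ι] [Finite V] [Finite U]
    (σ : ι → Tree n (V ⊕ M)) (τ : ι → Tree n (U ⊕ M)) :
    (∀ z z', polyMap f.toEquiv id σ z ≠ polyMap f.toEquiv id τ z') ∨
    ∃ (W : Type) (_ : Fintype W) (α : V → Tree n (W ⊕ M)) (β : U → Tree n (W ⊕ M)),
      (∀ z z', polyMap f.toEquiv id σ z = polyMap f.toEquiv id τ z' ↔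
        ∃ x, polyMap f.toEquiv id α x = z ∧ polyMap f.toEquiv id β x = z') ∧
      ∀ x x', polyMap f.toEquiv id α x = polyMap f.toEquiv id α x' →
        polyMap f.toEquiv id β x = polyMap f.toEquiv id β x' → x = x' := by
  cases nonempty_fintype ι
  let E : List (Tree n ((V ⊕ U) ⊕ M) × Tree n ((V ⊕ U) ⊕ M)) :=
    Finset.univ.toList.map fun i => (renameVar .inl (σ i), renameVar .inr (τ i))
  have hE : ∀ z, z ∈ solutions f.toEquiv E ↔
      polyMap f.toEquiv id σ (z ∘ .inl) = polyMap f.toEquiv id τ (z ∘ .inr) := by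
    intro z
    simp only [solutions, E, List.forall_mem_map, Finset.mem_toList, Finset.mem_univ,
      forall_const, Set.mem_ofPred_eq, eval_renameVar, funext_iff, polyMap]
  -- The fibre product is the solution set of a system in the joint variables; `α` and `β` are the
  -- two halves of its parametrization.
  rcases isClosedSet_solutions f E with h | ⟨k, W, hW, ρ, -, hρ, h⟩
  · refine Or.inl fun z z' hz => ?_
    have : Sum.elim z z' ∈ solutions f.toEquiv E := (hE _).2 hz
    rw [h] at this
    exact this
  · refine Or.inr ⟨W, hW, ρ ∘ .inl, ρ ∘ .inr, fun z z' => ?_, fun x x' h1 h2 => hρ ?_⟩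
    · have : Sum.elim z z' ∈ solutions f.toEquiv E ↔ _ := hE _
      rw [Sum.elim_comp_inl, Sum.elim_comp_inr, ← h] at this
      rw [← this]
      constructor
      · rintro ⟨x, hx⟩
        exact ⟨x, funext fun v => congrFun hx (.inl v), funext fun v => congrFun hx (.inr v)⟩
      · rintro ⟨x, rfl, rfl⟩
        refine ⟨x, ?_⟩
        funext v
        rcases v with v | v <;> rfl
    · funext v
      rcases v with v | v
      · exact congrFun h1 v
      · exact congrFun h2 v

/-- In the fibre product with a parametrization `τ` of the cell, injectivity of `τ` makes the
projection to `M ^ V` injective, and its range is the preimage. -/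
theorem IsClosedSet.preimage {f : AcyclicPairing n M} [Nonempty M] [Finite ι] [Finite V]
    {S : Set (ι → M)} (h : IsClosedSet f.toEquiv S) (σ : ι → Tree n (V ⊕ M)) :
    IsClosedSet f.toEquiv (polyMap f.toEquiv id σ ⁻¹' S) := by
  rcases h with rfl | ⟨k, U, _, τ, -, hτ, rfl⟩
  · exact Or.inl preimage_empty
  · rcases exists_fiberProduct f σ τ with h | ⟨W, hW, α, β, h, h'⟩
    · refine Or.inl (eq_empty_of_forall_notMem ?_)
      rintro z ⟨z', hz⟩
      exact h z z' hz.symm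
    · refine Or.inr ⟨_, W, hW, α, rfl, fun x x' hx => h' x x' hx (hτ ?_), ?_⟩
      · rw [← (h _ _).2 ⟨x, rfl, rfl⟩, ← (h _ _).2 ⟨x', rfl, rfl⟩, hx]
      · ext z
        constructor
        · rintro ⟨x, rfl⟩
          exact ⟨_, ((h _ _).2 ⟨x, rfl, rfl⟩).symm⟩
        · rintro ⟨z', hz⟩
          obtain ⟨x, hx, -⟩ := (h _ _).1 hz.symm
          exact ⟨x, hx⟩

theorem IsClosedSet.inter {f : AcyclicPairing n M} [Nonempty M] [Finite ι]
    {S T : Set (ι → M)} (hS : IsClosedSet f.toEquiv S) (hT : IsClosedSet f.toEquiv T) :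
    IsClosedSet f.toEquiv (S ∩ T) := by
  rcases hS with rfl | ⟨k, U, _, τ, -, hτ, rfl⟩
  · exact Or.inl (empty_inter _)
  · rw [inter_comm, ← image_preimage_eq_inter_range]
    exact (hT.preimage τ).image hτ

/-- A family of trees only depends on the variables that occur in it, and determines them. -/
theorem exists_factor (f : M ≃ (Fin n → M)) [Nonempty M] (τ : ι → Tree n (V ⊕ M)) :
    ∃ τ' : ι → Tree n ({v : V // ∃ i, (τ i).Mem (.inl v)} ⊕ M),
      (∀ z, polyMap f id τ z = polyMap f id τ' fun v => z v.1) ∧ Injective (polyMap f id τ') := by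
  classical
  let g : V ⊕ M → {v : V // ∃ i, (τ i).Mem (.inl v)} ⊕ M := Sum.elim
    (fun v => if h : ∃ i, (τ i).Mem (.inl v) then .inl ⟨v, h⟩ else .inr (Classical.arbitrary M))
    .inr
  have h : ∀ z, polyMap f id τ z = polyMap f id (fun i => (τ i).bind fun a => .leaf (g a))
      fun v => z v.1 := by
    intro z
    funext i
    simp only [polyMap, Tree.eval_bind]
    refine Tree.eval_congr f fun a ha => ?_
    rcases a with v | c
    · have hv : ∃ i, (τ i).Mem (.inl v) := ⟨i, ha⟩
      simp [g, hv, Tree.eval]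
    · rfl
  refine ⟨_, h, fun z z' hz => funext fun ⟨v, i, hv⟩ => ?_⟩
  have hext : ∀ z : {v : V // ∃ i, (τ i).Mem (.inl v)} → M, ∃ y : V → M, (fun v => y v.1) = z :=
    fun z => ⟨fun v => if h : ∃ i, (τ i).Mem (.inl v) then z ⟨v, h⟩ else Classical.arbitrary M,
      funext fun v => dif_pos v.2⟩
  obtain ⟨y, rfl⟩ := hext z
  obtain ⟨y', rfl⟩ := hext z'
  -- Reading the value along the path to an occurrence of the variable recovers that variable, which
  -- gives injectivity.
  obtain ⟨l, hl, -⟩ := Tree.exists_word_of_mem f hv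
  rw [← h, ← h] at hz
  have h1 := hl (Sum.elim y id)
  have h2 := hl (Sum.elim y' id)
  have h3 : (τ i).eval f (Sum.elim y id) = (τ i).eval f (Sum.elim y' id) := congrFun hz i
  rw [h3, h2] at h1
  exact h1.symm

end Cells

/-! ### Generic points and irreducibility -/

section Generic

variable {n : ℕ} {M : Type w} {P : Type v} {V U : Type}

/-- The coordinates of `x` and their images under words of length at most `d` are pairwise distinct
and not in `C`. -/
def Generic (f : M ≃ (Fin n → M)) (d : ℕ) (C : Set M) (x : V → M) : Prop :=
  (∀ v v' l l', l.length ≤ d → l'.length ≤ d → word f l (x v) = word f l' (x v') →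
    v = v' ∧ l = l') ∧ ∀ v l, l.length ≤ d → word f l (x v) ∉ C

theorem Generic.mono {f : M ≃ (Fin n → M)} {d d' : ℕ} {C C' : Set M} {x : V → M}
    (h : Generic f d C x) (hd : d' ≤ d) (hC : C' ⊆ C) : Generic f d' C' x :=
  ⟨fun v v' l l' hl hl' => h.1 v v' l l' (hl.trans hd) (hl'.trans hd),
    fun v l hl hc => h.2 v l (hl.trans hd) (hC hc)⟩

/-- Iterates of one component never repeat, since a repetition would be a fixed point of a nonempty
word. -/
theorem AcyclicPairing.infinite [Nonempty M] (f : AcyclicPairing n M) : Infinite M := by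
  obtain ⟨x⟩ := ‹Nonempty M›
  have hadd : ∀ (l l' : List (Fin n)) y,
      word f.toEquiv (l ++ l') y = word f.toEquiv l' (word f.toEquiv l y) := by
    intro l
    induction l with
    | nil => exact fun _ _ => rfl
    | cons a l ih => exact fun l' y => ih l' _
  have hlt : ∀ i j : ℕ, i < j → word f.toEquiv (List.replicate i ⟨0, f.pos⟩) x ≠
      word f.toEquiv (List.replicate j ⟨0, f.pos⟩) x := by
    intro i j hij h
    obtain ⟨k, rfl⟩ := Nat.exists_eq_add_of_lt hij
    rw [Nat.add_assoc, List.replicate_add, hadd] at h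
    exact f.word_ne _ (by simp) _ h.symm
  refine Infinite.of_injective (fun i : ℕ => word f.toEquiv (List.replicate i ⟨0, f.pos⟩) x) ?_
  intro i j hij
  rcases lt_trichotomy i j with h | h | h
  · exact absurd hij (hlt i j h)
  · exact h
  · exact absurd hij.symm (hlt j i h)

/-- Coordinates are added one at a time, the new one avoiding the finitely many short word values of
the previous ones. -/
theorem exists_generic_of_unit (f : M ≃ (Fin n → M)) [Nonempty M] (d : ℕ)
    (h : ∀ C : Set M, C.Finite → ∃ y : M, Generic f d C fun _ : Unit => y) (V : Type) [Finite V]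
    (C : Set M) (hC : C.Finite) : ∃ x : V → M, Generic f d C x := by
  induction V using Finite.induction_empty_option with
  | of_equiv e ih =>
    obtain ⟨x, hx⟩ := ih
    refine ⟨x ∘ e.symm, fun v v' l l' hl hl' hv => ?_, fun v l hl => hx.2 _ l hl⟩
    obtain ⟨h1, h2⟩ := hx.1 _ _ l l' hl hl' hv
    exact ⟨e.symm.injective h1, h2⟩
  | h_empty => exact ⟨fun v => v.elim, fun v => v.elim, fun v => v.elim⟩
  | h_option ih =>
    rename_i V _
    obtain ⟨x, hx⟩ := ih
    have hfin : {l : List (Fin n) | l.length ≤ d}.Finite := List.finite_length_le _ _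
    let C' : Set M := C ∪ image2 (fun v l => word f l (x v)) univ {l | l.length ≤ d}
    obtain ⟨y, hy⟩ := h C' (hC.union (finite_univ.image2 _ hfin))
    have hne : ∀ v l l', l.length ≤ d → l'.length ≤ d → word f l (x v) ≠ word f l' y :=
      fun v l l' hl hl' h => hy.2 () l' hl' (Or.inr ⟨v, mem_univ _, l, hl, h⟩)
    refine ⟨fun o => o.elim y x, ?_, ?_⟩
    · rintro (_ | v) (_ | v') l l' hl hl' hv
      · exact ⟨rfl, (hy.1 () () l l' hl hl' hv).2⟩
      · exact absurd hv.symm (hne v' l' l hl' hl)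
      · exact absurd hv (hne v l l' hl hl')
      · obtain ⟨h1, h2⟩ := hx.1 v v' l l' hl hl' hv
        exact ⟨congrArg some h1, h2⟩
    · rintro (_ | v) l hl
      · exact fun h => hy.2 () l hl (Or.inl h)
      · exact hx.2 v l hl

/-- Induction on the depth. If `x` is an `n`-tuple generic to depth `d`, then nonempty words of
length at most `d + 1` at `f⁻¹ x` are words of length at most `d` at coordinates of `x`, and
acyclicity separates them from the empty word. -/
theorem exists_generic (f : AcyclicPairing n M) [Nonempty M] (d : ℕ) (V : Type) [Finite V]
    (C : Set M) (hC : C.Finite) : ∃ x : V → M, Generic f.toEquiv d C x := by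
  refine exists_generic_of_unit _ d ?_ V C hC
  clear hC C
  induction d with
  | zero =>
    intro C hC
    have := f.infinite
    obtain ⟨y, hy⟩ := hC.exists_notMem
    refine ⟨y, fun v v' l l' hl hl' _ => ⟨rfl, ?_⟩, fun v l hl => ?_⟩
    · rw [List.eq_nil_of_length_eq_zero (Nat.le_zero.1 hl),
        List.eq_nil_of_length_eq_zero (Nat.le_zero.1 hl')]
    · rw [List.eq_nil_of_length_eq_zero (Nat.le_zero.1 hl)]
      exact hy
  | succ d ih =>
    intro C hC
    let i0 : Fin n := ⟨0, f.pos⟩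
    -- Avoiding the `i0`-components of `C` as well keeps `f⁻¹ x` itself out of `C`.
    obtain ⟨x, hx⟩ := exists_generic_of_unit _ d ih (Fin n)
      (C ∪ (fun c => f.toEquiv c i0) '' C) (hC.union (hC.image _))
    have hw : ∀ a l, word f.toEquiv (a :: l) (f.toEquiv.symm x) = word f.toEquiv l (x a) := by
      intro a l
      simp [word]
    refine ⟨f.toEquiv.symm x, fun v v' l l' hl hl' h => ⟨rfl, ?_⟩, fun v l hl => ?_⟩
    · rcases l with _ | ⟨a, l⟩ <;> rcases l' with _ | ⟨a', l'⟩
      · rfl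
      · exact absurd h.symm (f.word_ne _ (by simp) _)
      · exact absurd h (f.word_ne _ (by simp) _)
      · rw [hw, hw] at h
        obtain ⟨h1, h2⟩ := hx.1 _ _ _ _ (by simpa using hl) (by simpa using hl') h
        rw [h1, h2]
    · rcases l with _ | ⟨a, l⟩
      · intro h
        refine hx.2 i0 [] (Nat.zero_le _) (Or.inr ⟨_, h, ?_⟩)
        simp [word]
      · rw [hw]
        exact fun h => hx.2 a l (by simpa using hl) (Or.inl h)

/-- A set without generic points. -/
def Thin (f : M ≃ (Fin n → M)) (S : Set (V → M)) : Prop :=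
  ∃ d C, C.Finite ∧ ∀ x ∈ S, ¬ Generic f d C x

theorem not_thin_univ (f : AcyclicPairing n M) [Nonempty M] [Finite V] :
    ¬ Thin f.toEquiv (univ : Set (V → M)) := by
  rintro ⟨d, C, hC, h⟩
  obtain ⟨x, hx⟩ := exists_generic f d V C hC
  exact h x (mem_univ x) hx

theorem Thin.union {f : M ≃ (Fin n → M)} {S T : Set (V → M)} (hS : Thin f S) (hT : Thin f T) :
    Thin f (S ∪ T) := by
  obtain ⟨d, C, hC, h⟩ := hS
  obtain ⟨d', C', hC', h'⟩ := hT
  refine ⟨max d d', C ∪ C', hC.union hC', ?_⟩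
  rintro x (hx | hx) hg
  · exact h x hx (hg.mono (le_max_left _ _) subset_union_left)
  · exact h' x hx (hg.mono (le_max_right _ _) subset_union_right)

theorem thin_empty (f : M ≃ (Fin n → M)) : Thin f (∅ : Set (V → M)) :=
  ⟨0, ∅, finite_empty, fun _ h => h.elim⟩

theorem thin_sUnion {f : M ≃ (Fin n → M)} {F : Set (Set (V → M))} (hF : F.Finite)
    (h : ∀ S ∈ F, Thin f S) : Thin f (⋃₀ F) := by
  induction F, hF using Set.Finite.induction_on with
  | empty => simpa using thin_empty f
  | insert _ _ ih =>
    rw [sUnion_insert]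
    exact (h _ (mem_insert _ _)).union (ih fun S hS => h S (mem_insert_of_mem _ hS))

/-- A coordinate that is a node is replaced by the `n` coordinates of its children until only leaves
remain. Relations, surjectivity and injectivity pass between the two maps, and `r ^ n = r` hides the
change in the number of coordinates. A map with only leaves has a constant coordinate, repeats a
variable, or is a coordinate projection. The case is decided by the trees alone, uniformly in the
parameter values `e`. -/
theorem polyMap_trichotomy (f : M ≃ (Fin n → M)) [Nontrivial M] {R : Type*} [CommMonoid R] {r : R}
    (hr : r ^ n = r) [Fintype V] [Fintype U] (ρ : V → Tree n (U ⊕ P)) :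
    (∃ v l q, ∀ e z, word f l (polyMap f e ρ z v) = e q) ∨
    (∃ v l v' l', ¬ (v = v' ∧ l = l') ∧ ∀ e z,
      word f l (polyMap f e ρ z v) = word f l' (polyMap f e ρ z v')) ∨
    ((∀ e, Surjective (polyMap f e ρ)) ∧
      ∀ e, Injective (polyMap f e ρ) → r ^ Fintype.card V = r ^ Fintype.card U) := by
  classical
  induction hN : ∑ v, (ρ v).nodes using Nat.strong_induction_on generalizing V with
  | _ N ih =>
    subst hN
    by_cases hnode : ∃ v t, ρ v = .node t
    · obtain ⟨v, t, hv⟩ := hnode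
      let ρ' : {u : V // u ≠ v} ⊕ Fin n → Tree n (U ⊕ P) := Sum.elim (fun u => ρ u.1) t
      have hsum : ∑ u, (ρ' u).nodes < ∑ u, (ρ u).nodes := by
        rw [Fintype.sum_sum_type, Fintype.sum_eq_add_sum_subtype_ne (fun u => (ρ u).nodes) v, hv]
        simp only [ρ', Sum.elim_inl, Sum.elim_inr, Tree.nodes]
        omega
      let pos : ({u : V // u ≠ v} ⊕ Fin n) → List (Fin n) → V × List (Fin n) :=
        fun u l => u.elim (fun u => (u.1, l)) fun i => (v, i :: l)
      have hpos : ∀ u l u' l', pos u l = pos u' l' → u = u' ∧ l = l' := by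
        rintro (u | i) l (u' | i') l' h
        · obtain ⟨h1, h2⟩ := Prod.mk.inj h
          exact ⟨congrArg _ (Subtype.ext h1), h2⟩
        · exact absurd (Prod.mk.inj h).1 u.2
        · exact absurd (Prod.mk.inj h).1.symm u'.2
        · have h1 := (Prod.mk.inj h).2
          simp only [List.cons.injEq] at h1
          exact ⟨congrArg _ h1.1, h1.2⟩
      have hfv : ∀ e z, f (polyMap f e ρ z v) = fun i => polyMap f e ρ' z (.inr i) := by
        intro e z
        simp only [polyMap, hv, Tree.eval, Equiv.apply_symm_apply]
        rfl
      have hval : ∀ e z u l, word f l (polyMap f e ρ' z u) =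
          word f (pos u l).2 (polyMap f e ρ z (pos u l).1) := by
        rintro e z (u | i) l
        · rfl
        · simp only [pos, Sum.elim_inr, word, hfv]
      rcases ih _ hsum ρ' rfl with ⟨u, l, q, h⟩ | ⟨u, l, u', l', hne, h⟩ | ⟨h, h'⟩
      · exact Or.inl ⟨_, _, q, fun e z => (hval e z u l).symm.trans (h e z)⟩
      · refine Or.inr (Or.inl ⟨(pos u l).1, (pos u l).2, (pos u' l').1, (pos u' l').2, ?_, ?_⟩)
        · exact fun hh => hne (hpos _ _ _ _ (Prod.ext hh.1 hh.2))
        · intro e z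
          rw [← hval, ← hval]
          exact h e z
      · have hext : ∀ e z z', polyMap f e ρ z = polyMap f e ρ z' →
            polyMap f e ρ' z = polyMap f e ρ' z' := by
          intro e z z' hz
          funext u
          rcases u with u | i
          · exact congrFun hz u.1
          · have h1 := hfv e z
            rw [hz, hfv] at h1
            exact (congrFun h1 i).symm
        refine Or.inr (Or.inr ⟨fun e y => ?_, fun e he => ?_⟩)
        · obtain ⟨z, hz⟩ := h e (Sum.elim (fun u => y u.1) (f (y v)))
          refine ⟨z, funext fun u => ?_⟩
          by_cases hu : u = v
          · subst hu
            apply f.injective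
            rw [hfv, hz]
            rfl
          · exact congrFun hz (.inl ⟨u, hu⟩)
        · rw [← h' e fun z z' hz => he ?_]
          · have hV : Fintype.card {u : V // u ≠ v} + 1 = Fintype.card V := by
              have h1 := Fintype.sum_eq_add_sum_subtype_ne (fun _ : V => 1) v
              simp only [Finset.sum_const, Finset.card_univ, smul_eq_mul, mul_one] at h1
              rw [h1, add_comm]
            rw [Fintype.card_sum, Fintype.card_fin, pow_add, hr, ← hV, pow_succ]
          · funext u
            by_cases hu : u = v
            · subst hu
              apply f.injective
              rw [hfv, hfv, hz]
            · exact congrFun hz (.inl ⟨u, hu⟩)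
    · have hleaf : ∀ v, ∃ a, ρ v = .leaf a := by
        intro v
        rcases hv : ρ v with a | t
        · exact ⟨a, rfl⟩
        · exact absurd ⟨v, t, hv⟩ hnode
      choose g hg using hleaf
      by_cases hq : ∃ v q, g v = .inr q
      · obtain ⟨v, q, hv⟩ := hq
        exact Or.inl ⟨v, [], q, fun e z => by simp [word, polyMap, hg, hv, Tree.eval]⟩
      · have hinl : ∀ v, ∃ u, g v = .inl u := by
          intro v
          rcases hv : g v with u | q
          · exact ⟨u, rfl⟩
          · exact absurd ⟨v, q, hv⟩ hq
        choose γ hγ using hinl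
        have hmap : ∀ e, polyMap f e ρ = fun z => z ∘ γ := by
          intro e
          funext z v
          simp [polyMap, hg, hγ, Tree.eval]
        by_cases hinj : Injective γ
        · refine Or.inr (Or.inr ⟨fun e => ?_, fun e he => ?_⟩)
          · rw [hmap]
            exact hinj.surjective_comp_right
          · rw [hmap] at he
            have hsurj : Surjective γ := by
              by_contra hs
              -- A variable missed by `γ` could be changed without affecting the value, as `M` has
              -- two elements.
              simp only [Surjective, not_forall, not_exists] at hs
              obtain ⟨u, hu⟩ := hs
              obtain ⟨a, b, hab⟩ := exists_pair_ne M
              have h1 := @he (fun _ => a) (update (fun _ => a) u b) (by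
                funext v
                simp [update_of_ne (hu v)])
              have h2 := congrFun h1 u
              rw [update_self] at h2
              exact hab h2
            rw [Fintype.card_of_bijective ⟨hinj, hsurj⟩]
        · simp only [Injective, not_forall] at hinj
          obtain ⟨v, v', h1, h2⟩ := hinj
          exact Or.inr (Or.inl ⟨v, [], v', [], fun h => h2 h.1, fun e z => by
            simp [word, hmap, h1]⟩)

theorem thin_of_forall_word_eq_const {f : M ≃ (Fin n → M)} {S : Set (V → M)} {v : V}
    {l : List (Fin n)} {c : M} (h : ∀ x ∈ S, word f l (x v) = c) : Thin f S :=
  ⟨l.length, {c}, finite_singleton c, fun x hx hg => hg.2 v l le_rfl (h x hx)⟩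

theorem thin_of_forall_word_eq_word {f : M ≃ (Fin n → M)} {S : Set (V → M)} {v v' : V}
    {l l' : List (Fin n)} (hne : ¬ (v = v' ∧ l = l'))
    (h : ∀ x ∈ S, word f l (x v) = word f l' (x v')) : Thin f S :=
  ⟨max l.length l'.length, ∅, finite_empty, fun x hx hg =>
    hne (hg.1 v v' l l' (le_max_left _ _) (le_max_right _ _) (h x hx))⟩

theorem surjective_or_thin (f : M ≃ (Fin n → M)) [Nontrivial M] [Finite V] [Finite U]
    (ρ : V → Tree n (U ⊕ P)) :
    (∀ e, Surjective (polyMap f e ρ)) ∨ ∀ e, Thin f (range (polyMap f e ρ)) := by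
  cases nonempty_fintype V
  cases nonempty_fintype U
  -- Only surjectivity matters here, so `r = 1` makes the exponent clause void.
  rcases polyMap_trichotomy f (one_pow n : (1 : ℕ) ^ n = 1) ρ with
    ⟨v, l, q, h⟩ | ⟨v, l, v', l', hne, h⟩ | ⟨h, -⟩
  · exact Or.inr fun e => thin_of_forall_word_eq_const (by
      rintro _ ⟨z, rfl⟩
      exact h e z)
  · exact Or.inr fun e => thin_of_forall_word_eq_word hne (by
      rintro _ ⟨z, rfl⟩
      exact h e z)
  · exact Or.inl h

/-- The dichotomy of `surjective_or_thin` is uniform in the parameters, and surjectivity at `e`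
excludes thinness because generic points exist. -/
theorem surjective_polyMap_of_surjective (f : AcyclicPairing n M) [Nonempty M] [Finite V]
    [Finite U] {ρ : V → Tree n (U ⊕ P)} {e : P → M} (h : Surjective (polyMap f.toEquiv e ρ))
    (e' : P → M) : Surjective (polyMap f.toEquiv e' ρ) := by
  have := f.infinite
  rcases surjective_or_thin f.toEquiv ρ with h' | h'
  · exact h' e'
  · have := h' e
    rw [h.range_eq] at this
    exact absurd this (not_thin_univ f)

theorem pow_card_eq_of_bijective (f : AcyclicPairing n M) [Nonempty M] {R : Type*} [CommMonoid R]
    {r : R} (hr : r ^ n = r) [Fintype V] [Fintype U] {ρ : V → Tree n (U ⊕ P)} {e : P → M}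
    (h : Bijective (polyMap f.toEquiv e ρ)) : r ^ Fintype.card V = r ^ Fintype.card U := by
  have := f.infinite
  rcases polyMap_trichotomy f.toEquiv hr ρ with
    ⟨v, l, q, h'⟩ | ⟨v, l, v', l', hne, h'⟩ | ⟨-, h'⟩
  · refine absurd (thin_of_forall_word_eq_const (v := v) (l := l) (c := e q) fun x _ => ?_)
      (not_thin_univ (V := V) f)
    obtain ⟨z, rfl⟩ := h.2 x
    exact h' e z
  · refine absurd (thin_of_forall_word_eq_word hne fun x _ => ?_) (not_thin_univ (V := V) f)
    obtain ⟨z, rfl⟩ := h.2 x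
    exact h' e z
  · exact h' e h.1

theorem IsClosedSet.eq_univ_or_thin {f : AcyclicPairing n M} [Nonempty M] [Finite V]
    {S : Set (V → M)} (h : IsClosedSet f.toEquiv S) : S = univ ∨ Thin f.toEquiv S := by
  have := f.infinite
  rcases h with rfl | ⟨k, U, _, ρ, -, -, rfl⟩
  · exact Or.inr (thin_empty _)
  · exact (surjective_or_thin f.toEquiv ρ).imp (fun h => (h id).range_eq) fun h => h id

/-- Irreducibility of `M ^ V`. -/
theorem univ_mem_of_sUnion_eq_univ {f : AcyclicPairing n M} [Nonempty M] [Finite V]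
    {F : Set (Set (V → M))} (hF : F.Finite) (h : ∀ S ∈ F, IsClosedSet f.toEquiv S)
    (hU : ⋃₀ F = univ) : univ ∈ F := by
  by_contra hne
  refine not_thin_univ (V := V) f (hU ▸ thin_sUnion hF fun S hS => ?_)
  exact (h S hS).eq_univ_or_thin.resolve_left fun hS' => hne (hS' ▸ hS)

/-- Irreducibility of cells. -/
theorem IsCell.subset_of_subset_sUnion {ι : Type} {f : AcyclicPairing n M} [Nonempty M] [Finite ι]
    {k : ℕ} {B : Set (ι → M)} (hB : IsCell f.toEquiv k B) {F : Set (Set (ι → M))} (hF : F.Finite)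
    (h : ∀ S ∈ F, IsClosedSet f.toEquiv S) (hU : B ⊆ ⋃₀ F) : ∃ S ∈ F, B ⊆ S := by
  obtain ⟨V, _, σ, -, -, rfl⟩ := hB
  have := univ_mem_of_sUnion_eq_univ (f := f)
    (F := (fun S => polyMap f.toEquiv id σ ⁻¹' S) '' F) (hF.image _) (by
      rintro _ ⟨S, hS, rfl⟩
      exact (h S hS).preimage σ) (eq_univ_of_forall fun z => by
        obtain ⟨S, hS, hz⟩ := hU ⟨z, rfl⟩
        exact ⟨_, ⟨S, hS, rfl⟩, hz⟩)
  obtain ⟨S, hS, hz⟩ := this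
  refine ⟨S, hS, ?_⟩
  rintro _ ⟨z, rfl⟩
  exact eq_univ_iff_forall.1 hz z

/-- The dimension of a cell is well-defined as an exponent of elements satisfying `r ^ n = r`. -/
theorem IsCell.pow_eq {ι : Type} {f : AcyclicPairing n M} [Nonempty M] [Finite ι] {R : Type*}
    [CommMonoid R] {r : R} (hr : r ^ n = r) {k k' : ℕ} {B : Set (ι → M)}
    (h : IsCell f.toEquiv k B) (h' : IsCell f.toEquiv k' B) : r ^ k = r ^ k' := by
  obtain ⟨V, _, σ, rfl, hσ, rfl⟩ := h
  obtain ⟨U, _, τ, rfl, hτ, hB⟩ := h'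
  rcases exists_fiberProduct f σ τ with h | ⟨W, hW, α, β, h, hinj⟩
  · obtain ⟨z⟩ : Nonempty (V → M) := inferInstance
    obtain ⟨z', hz⟩ := hB.symm ▸ mem_range_self (f := polyMap f.toEquiv id σ) z
    exact absurd hz.symm (h z z')
  -- Both projections of the fibre product of the two parametrizations are bijective, so both
  -- exponents can be compared with the number of its parameters.
  · have hαβ : ∀ x, polyMap f.toEquiv id σ (polyMap f.toEquiv id α x) =
        polyMap f.toEquiv id τ (polyMap f.toEquiv id β x) := fun x => (h _ _).2 ⟨x, rfl, rfl⟩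
    have hα : Bijective (polyMap f.toEquiv id α) := by
      refine ⟨fun x x' hx => hinj x x' hx (hτ ?_), fun z => ?_⟩
      · rw [← hαβ, ← hαβ, hx]
      · obtain ⟨z', hz⟩ := hB.symm ▸ mem_range_self (f := polyMap f.toEquiv id σ) z
        obtain ⟨x, hx, -⟩ := (h z z').1 hz.symm
        exact ⟨x, hx⟩
    have hβ : Bijective (polyMap f.toEquiv id β) := by
      refine ⟨fun x x' hx => hinj x x' (hσ ?_) hx, fun z => ?_⟩
      · rw [hαβ, hαβ, hx]
      · obtain ⟨z', hz⟩ := hB ▸ mem_range_self (f := polyMap f.toEquiv id τ) z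
        obtain ⟨x, -, hx⟩ := (h z' z).1 hz
        exact ⟨x, hx⟩
    rw [pow_card_eq_of_bijective f hr hα, pow_card_eq_of_bijective f hr hβ]

end Generic

/-! ### Constructible sets -/

section Constructible

variable {n : ℕ} {M : Type w} {V U ι κ : Type}

/-- A Boolean combination of finitely many closed sets. -/
def Constructible (f : M ≃ (Fin n → M)) (S : Set (ι → M)) : Prop :=
  ∃ F : Set (Set (ι → M)), F.Finite ∧ (∀ T ∈ F, IsClosedSet f T) ∧
    ∀ x y, (∀ T ∈ F, x ∈ T ↔ y ∈ T) → (x ∈ S ↔ y ∈ S)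

theorem IsClosedSet.constructible {f : M ≃ (Fin n → M)} {S : Set (ι → M)} (h : IsClosedSet f S) :
    Constructible f S :=
  ⟨{S}, finite_singleton S, by simpa using h, fun x y hxy => hxy S rfl⟩

namespace Constructible

theorem empty (f : M ≃ (Fin n → M)) : Constructible f (∅ : Set (ι → M)) :=
  IsClosedSet.constructible (Or.inl rfl)

theorem compl {f : M ≃ (Fin n → M)} {S : Set (ι → M)} (h : Constructible f S) :
    Constructible f Sᶜ := by
  obtain ⟨F, hF, hc, h⟩ := h
  exact ⟨F, hF, hc, fun x y hxy => not_congr (h x y hxy)⟩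

theorem inter {f : M ≃ (Fin n → M)} {S T : Set (ι → M)} (hS : Constructible f S)
    (hT : Constructible f T) : Constructible f (S ∩ T) := by
  obtain ⟨F, hF, hc, h⟩ := hS
  obtain ⟨F', hF', hc', h'⟩ := hT
  refine ⟨F ∪ F', hF.union hF', ?_, fun x y hxy => ?_⟩
  · rintro A (hA | hA)
    · exact hc A hA
    · exact hc' A hA
  · exact and_congr (h x y fun A hA => hxy A (Or.inl hA)) (h' x y fun A hA => hxy A (Or.inr hA))

theorem union {f : M ≃ (Fin n → M)} {S T : Set (ι → M)} (hS : Constructible f S)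
    (hT : Constructible f T) : Constructible f (S ∪ T) := by
  rw [← compl_compl (S ∪ T), compl_union]
  exact (hS.compl.inter hT.compl).compl

theorem biUnion {f : M ≃ (Fin n → M)} {α : Type*} {F : Set α} (hF : F.Finite)
    {S : α → Set (ι → M)} (h : ∀ a ∈ F, Constructible f (S a)) :
    Constructible f (⋃ a ∈ F, S a) := by
  induction F, hF using Set.Finite.induction_on with
  | empty => simpa using empty f
  | insert _ _ ih =>
    rw [biUnion_insert]
    exact (h _ (mem_insert _ _)).union (ih fun a ha => h a (mem_insert_of_mem _ ha))

theorem diff_sUnion {f : M ≃ (Fin n → M)} {D : Set (ι → M)} (hD : IsClosedSet f D)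
    {G : Set (Set (ι → M))} (hG : G.Finite) (h : ∀ T ∈ G, IsClosedSet f T) :
    Constructible f (D \ ⋃₀ G) := by
  rw [sUnion_eq_biUnion]
  exact hD.constructible.inter (biUnion hG fun T hT => (h T hT).constructible).compl

/-- Constructible sets are finite disjoint unions of differences of closed sets. -/
theorem induction {f : AcyclicPairing n M} [Nonempty M] [Finite ι] {P : Set (ι → M) → Prop}
    (empty : P ∅)
    (diff : ∀ D, IsClosedSet f.toEquiv D → ∀ G : Set (Set (ι → M)), G.Finite →
      (∀ T ∈ G, IsClosedSet f.toEquiv T) → P (D \ ⋃₀ G))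
    (union : ∀ S T, Constructible f.toEquiv S → Constructible f.toEquiv T → Disjoint S T →
      P S → P T → P (S ∪ T))
    {S : Set (ι → M)} (hS : Constructible f.toEquiv S) : P S := by
  have hcon := hS
  obtain ⟨F, hF, hc, h⟩ := hS
  -- Relative version: `S` need only be determined by `F` inside `D \ ⋃₀ G`. Each `T` of `F` cuts
  -- this piece into two of the same form, on each of which membership in `T` is constant.
  suffices H : ∀ D, IsClosedSet f.toEquiv D → ∀ G : Set (Set (ι → M)), G.Finite →
      (∀ T ∈ G, IsClosedSet f.toEquiv T) →
      (∀ x ∈ D \ ⋃₀ G, ∀ y ∈ D \ ⋃₀ G, (∀ T ∈ F, x ∈ T ↔ y ∈ T) → (x ∈ S ↔ y ∈ S)) →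
      P (S ∩ (D \ ⋃₀ G)) by
    simpa using H univ (isClosedSet_univ _) ∅ finite_empty (by simp) fun x _ y _ => h x y
  clear h
  induction F, hF using Set.Finite.induction_on with
  | empty =>
    intro D hD G hG hGc h
    by_cases hne : ∃ x ∈ D \ ⋃₀ G, x ∈ S
    · obtain ⟨x, hx, hxS⟩ := hne
      rw [inter_eq_right.2 fun y hy => (h x hx y hy (by simp)).1 hxS]
      exact diff D hD G hG hGc
    · convert! empty using 1
      exact eq_empty_of_forall_notMem fun x hx => hne ⟨x, hx.2, hx.1⟩
  | @insert T F _ _ ih =>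
    intro D hD G hG hGc h
    have hT := hc T (mem_insert _ _)
    have hc' : ∀ A ∈ F, IsClosedSet f.toEquiv A := fun A hA => hc A (mem_insert_of_mem _ hA)
    have hG' : ∀ A ∈ insert T G, IsClosedSet f.toEquiv A := by
      rintro A (rfl | hA)
      · exact hT
      · exact hGc A hA
    have h1 : (D ∩ T) \ ⋃₀ G ⊆ D \ ⋃₀ G := fun x hx => ⟨hx.1.1, hx.2⟩
    have h2 : D \ ⋃₀ (insert T G) ⊆ D \ ⋃₀ G := fun x hx =>
      ⟨hx.1, fun hx' => hx.2 (by rw [sUnion_insert]; exact Or.inr hx')⟩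
    have e1 := ih hc' (D ∩ T) (hD.inter hT) G hG hGc fun x hx y hy hxy =>
      h x (h1 hx) y (h1 hy) (by
        rintro A (rfl | hA)
        · exact iff_of_true hx.1.2 hy.1.2
        · exact hxy A hA)
    have e2 := ih hc' D hD (insert T G) (hG.insert T) hG' fun x hx y hy hxy =>
      h x (h2 hx) y (h2 hy) (by
        rintro A (rfl | hA)
        · refine iff_of_false (fun hx' => hx.2 ?_) (fun hy' => hy.2 ?_) <;>
            rw [sUnion_insert]
          · exact Or.inl hx'
          · exact Or.inl hy'
        · exact hxy A hA)
    have := union _ _ (hcon.inter (diff_sUnion (hD.inter hT) hG hGc))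
      (hcon.inter (diff_sUnion hD (hG.insert T) hG')) ?_ e1 e2
    · convert! this using 1
      ext x
      simp only [sUnion_insert, mem_inter_iff, mem_sdiff, mem_union]
      tauto
    · rw [Set.disjoint_left]
      rintro x ⟨-, hx⟩ ⟨-, hx'⟩
      refine hx'.2 ?_
      rw [sUnion_insert]
      exact Or.inl hx.1.2

theorem image {f : M ≃ (Fin n → M)} [Finite V] {S : Set (V → M)} (h : Constructible f S)
    {σ : ι → Tree n (V ⊕ M)} (hσ : Injective (polyMap f id σ)) :
    Constructible f (polyMap f id σ '' S) := by
  obtain ⟨F, hF, hc, h⟩ := h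
  -- The range joins the family so that a point indistinguishable from an image point is an image
  -- point.
  refine ⟨insert (range (polyMap f id σ)) ((fun T => polyMap f id σ '' T) '' F),
    (hF.image _).insert _, ?_, ?_⟩
  · rintro T (rfl | ⟨T, hT, rfl⟩)
    · rw [← image_univ]
      exact (isClosedSet_univ f).image hσ
    · exact (hc T hT).image hσ
  · have key : ∀ x y, (∀ T ∈ insert (range (polyMap f id σ))
        ((fun T => polyMap f id σ '' T) '' F), x ∈ T ↔ y ∈ T) →
        x ∈ polyMap f id σ '' S → y ∈ polyMap f id σ '' S := by
      rintro _ y hxy ⟨z, hz, rfl⟩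
      obtain ⟨z', rfl⟩ := (hxy _ (mem_insert _ _)).1 ⟨z, rfl⟩
      refine ⟨z', (h z z' fun T hT => ?_).1 hz, rfl⟩
      have := hxy _ (mem_insert_of_mem _ ⟨T, hT, rfl⟩)
      rwa [hσ.mem_set_image, hσ.mem_set_image] at this
    exact fun x y hxy => ⟨key x y hxy, key y x fun T hT => (hxy T hT).symm⟩

theorem preimage {f : AcyclicPairing n M} [Nonempty M] [Finite ι] [Finite V] {S : Set (ι → M)}
    (h : Constructible f.toEquiv S) (σ : ι → Tree n (V ⊕ M)) :
    Constructible f.toEquiv (polyMap f.toEquiv id σ ⁻¹' S) := by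
  obtain ⟨F, hF, hc, h⟩ := h
  refine ⟨(fun T => polyMap f.toEquiv id σ ⁻¹' T) '' F, hF.image _, ?_, fun x y hxy =>
    h _ _ fun T hT => hxy _ ⟨T, hT, rfl⟩⟩
  rintro _ ⟨T, hT, rfl⟩
  exact (hc T hT).preimage σ

theorem preimage_comp {f : AcyclicPairing n M} [Nonempty M] [Finite ι] [Finite κ]
    {S : Set (κ → M)} (h : Constructible f.toEquiv S) (g : κ → ι) :
    Constructible f.toEquiv {x : ι → M | x ∘ g ∈ S} :=
  h.preimage fun k => .leaf (.inl (g k))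

end Constructible

/-! ### Projections of constructible sets -/

theorem exists_extend [Nonempty M] {p : V → Prop} (y : {v // p v} → M) :
    ∃ z : V → M, (fun v : {v // p v} => z v.1) = y := by
  classical
  exact ⟨fun v => if h : p v then y ⟨v, h⟩ else Classical.arbitrary M,
    funext fun v => dif_pos v.2⟩

/-- The values of some of the variables over which the whole fibre is contained in a closed set
form a closed set. -/
theorem IsClosedSet.forall_extend {f : AcyclicPairing n M} [Nonempty M] [Finite V]
    {T : Set (V → M)} (hT : IsClosedSet f.toEquiv T) (p : V → Prop) :
    IsClosedSet f.toEquiv {y : {v // p v} → M | ∀ z : V → M, (fun v => z v.1) = y → z ∈ T} := by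
  classical
  rcases eq_empty_or_nonempty {y : {v // p v} → M | ∀ z : V → M, (fun v => z v.1) = y → z ∈ T}
    with h0 | ⟨y₀, hy₀⟩
  · exact Or.inl h0
  rcases hT with rfl | ⟨k, U, _, ρ, -, -, rfl⟩
  · obtain ⟨z, hz⟩ := exists_extend y₀
    exact (hy₀ z hz).elim
  -- The coordinates in `p` determine the variables `q` occurring in them. With those treated as
  -- parameters, the other coordinates form a tree map `ρ'` in the remaining variables, and a full
  -- fibre means that `ρ'` is onto.
  obtain ⟨τ, hτ, hτi⟩ := exists_factor f.toEquiv fun v : {v // p v} => ρ v.1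
  let q : U → Prop := fun u => ∃ v : {v // p v}, (ρ v.1).Mem (.inl u)
  let c : U ⊕ M → {u // ¬ q u} ⊕ ({u // q u} ⊕ M) := Sum.elim
    (fun u => if h : q u then .inr (.inl ⟨u, h⟩) else .inl ⟨u, h⟩) fun m => .inr (.inr m)
  let ρ' : {v // ¬ p v} → Tree n ({u // ¬ q u} ⊕ ({u // q u} ⊕ M)) :=
    fun v => (ρ v.1).bind fun a => .leaf (c a)
  have hρ' : ∀ u : U → M, polyMap f.toEquiv (Sum.elim (fun w => u w.1) id) ρ' (fun w => u w.1) =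
      fun v => polyMap f.toEquiv id ρ u v.1 := by
    intro u
    funext v
    simp only [polyMap, ρ', Tree.eval_bind]
    congr 1
    funext a
    rcases a with a | a
    · by_cases h : q a <;> simp [c, h, Tree.eval]
    · rfl
  have hsplit : ∀ u : U → M, polyMap f.toEquiv id τ (fun w => u w.1) =
      fun v : {v // p v} => polyMap f.toEquiv id ρ u v.1 := fun u => (hτ u).symm
  obtain ⟨z₀, hz₀⟩ := exists_extend y₀
  obtain ⟨u₀, rfl⟩ := hy₀ z₀ hz₀
  rw [← hsplit] at hz₀
  have hs : Surjective (polyMap f.toEquiv (Sum.elim (fun w : {u // q u} => u₀ w.1) id) ρ') := by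
    intro z'
    let z : V → M := fun v => if h : p v then y₀ ⟨v, h⟩ else z' ⟨v, h⟩
    have hz : (fun v : {v // p v} => z v.1) = y₀ := funext fun v => dif_pos v.2
    obtain ⟨u, hu⟩ := hy₀ z hz
    rw [← hu, ← hsplit, ← hz₀] at hz
    refine ⟨fun w => u w.1, ?_⟩
    rw [← hτi hz, hρ', hu]
    funext v
    exact dif_neg v.2
  -- One full fibre forces every fibre over the range of `τ` to be full, since surjectivity of `ρ'`
  -- does not depend on the parameters.
  refine Or.inr ⟨_, _, inferInstance, τ, rfl, hτi, ?_⟩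
  ext y
  constructor
  · rintro ⟨a, rfl⟩ z hz
    obtain ⟨b, hb⟩ := surjective_polyMap_of_surjective f hs (Sum.elim a id) fun v => z v.1
    let u : U → M := fun w => if h : q w then a ⟨w, h⟩ else b ⟨w, h⟩
    have hua : (fun w : {u // q u} => u w.1) = a := funext fun w => dif_pos w.2
    have hub : (fun w : {u // ¬ q u} => u w.1) = b := funext fun w => dif_neg w.2
    refine ⟨u, funext fun v => ?_⟩
    by_cases hv : p v
    · have h1 := hsplit u
      rw [hua, ← hz] at h1
      exact (congrFun h1 ⟨v, hv⟩).symm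
    · have h1 := hρ' u
      rw [hua, hub, hb] at h1
      exact (congrFun h1 ⟨v, hv⟩).symm
  · intro hy
    obtain ⟨z, hz⟩ := exists_extend y
    obtain ⟨u, rfl⟩ := hy z hz
    exact ⟨fun w => u w.1, by rw [hsplit, ← hz]⟩

/-- A fibre of a coordinate projection is a copy of a power of `M`, hence irreducible. -/
theorem forall_extend_sUnion_iff (f : AcyclicPairing n M) [Nonempty M] [Finite V]
    {G : Set (Set (V → M))} (hG : G.Finite) (h : ∀ T ∈ G, IsClosedSet f.toEquiv T)
    (p : V → Prop) (y : {v // p v} → M) :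
    (∀ z : V → M, (fun v : {v // p v} => z v.1) = y → z ∈ ⋃₀ G) ↔
      ∃ T ∈ G, ∀ z : V → M, (fun v : {v // p v} => z v.1) = y → z ∈ T := by
  classical
  refine ⟨fun hy => ?_, fun ⟨T, hT, hy⟩ z hz => ⟨T, hT, hy z hz⟩⟩
  -- Parametrizes the fibre over `y` by the free coordinates.
  let σ : V → Tree n ({v // ¬ p v} ⊕ M) := fun v =>
    if h : p v then .leaf (.inr (y ⟨v, h⟩)) else .leaf (.inl ⟨v, h⟩)
  have hσ : ∀ z : V → M, (fun v : {v // p v} => z v.1) = y →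
      polyMap f.toEquiv id σ (fun v => z v.1) = z := by
    rintro z rfl
    funext v
    by_cases hv : p v <;> simp [polyMap, σ, hv, Tree.eval]
  have hσ' : ∀ z, (fun v : {v // p v} => polyMap f.toEquiv id σ z v.1) = y := by
    intro z
    funext v
    simp [polyMap, σ, v.2, Tree.eval]
  obtain ⟨T, hT, hU⟩ := univ_mem_of_sUnion_eq_univ (f := f)
    (F := (fun S => polyMap f.toEquiv id σ ⁻¹' S) '' G) (hG.image _) (by
      rintro _ ⟨S, hS, rfl⟩
      exact (h S hS).preimage σ) (eq_univ_of_forall fun z => by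
        obtain ⟨S, hS, hz⟩ := hy _ (hσ' z)
        exact ⟨_, ⟨S, hS, rfl⟩, hz⟩)
  refine ⟨T, hT, fun z hz => ?_⟩
  rw [← hσ z hz]
  exact eq_univ_iff_forall.1 hU _

/-- Coordinate projections of constructible sets are constructible. -/
theorem Constructible.image_comp {f : AcyclicPairing n M} [Nonempty M] [Finite ι]
    {S : Set (ι → M)} (hS : Constructible f.toEquiv S) (g : κ → ι) :
    Constructible f.toEquiv ((fun x : ι → M => x ∘ g) '' S) := by
  refine Constructible.induction (f := f)
    (P := fun S => Constructible f.toEquiv ((fun x : ι → M => x ∘ g) '' S)) ?_ ?_ ?_ hS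
  · rw [image_empty]
    exact .empty _
  · intro D hD G hG hc
    rcases hD with rfl | ⟨k, V, _, σ, -, -, rfl⟩
    · rw [empty_sdiff, image_empty]
      exact .empty _
    -- The projected cell is parametrized injectively by the variables that survive in `σ ∘ g`. A
    -- value of these is lost exactly when its whole fibre lies in the union of `G'`, hence in one
    -- member.
    obtain ⟨τ, hτ, hτi⟩ := exists_factor f.toEquiv (σ ∘ g)
    let p : V → Prop := fun v => ∃ i, ((σ ∘ g) i).Mem (.inl v)
    let G' : Set (Set (V → M)) := (fun S => polyMap f.toEquiv id σ ⁻¹' S) '' G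
    have hG' : G'.Finite := hG.image _
    have hc' : ∀ T ∈ G', IsClosedSet f.toEquiv T := by
      rintro _ ⟨S, hS, rfl⟩
      exact (hc S hS).preimage σ
    have hcon : Constructible f.toEquiv (⋃ T ∈ G', {y : {v // p v} → M |
        ∀ z : V → M, (fun v => z v.1) = y → z ∈ T})ᶜ :=
      (biUnion hG' fun T hT => ((hc' T hT).forall_extend p).constructible).compl
    convert! hcon.image hτi using 1
    ext y
    constructor
    · rintro ⟨_, ⟨⟨z, rfl⟩, hz⟩, rfl⟩
      refine ⟨fun v => z v.1, ?_, (hτ z).symm⟩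
      rw [mem_compl_iff, mem_iUnion₂]
      rintro ⟨_, ⟨S, hS, rfl⟩, hT⟩
      exact hz ⟨S, hS, hT z rfl⟩
    · rintro ⟨y, hy, rfl⟩
      have hy' : ¬ ∃ T ∈ G', ∀ z : V → M, (fun v : {v // p v} => z v.1) = y → z ∈ T := by
        rintro ⟨T, hT, h⟩
        exact hy (mem_iUnion₂.2 ⟨T, hT, h⟩)
      rw [← forall_extend_sUnion_iff f hG' hc'] at hy'
      push Not at hy'
      obtain ⟨z, rfl, hz⟩ := hy'
      refine ⟨_, ⟨⟨z, rfl⟩, ?_⟩, hτ z⟩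
      rintro ⟨S, hS, h⟩
      exact hz ⟨_, ⟨S, hS, rfl⟩, h⟩
  · intro S T _ _ _ h1 h2
    rw [image_union]
    exact h1.union h2

theorem Constructible.exists_option {f : AcyclicPairing n M} [Nonempty M] [Finite ι]
    {S : Set (Option ι → M)} (hS : Constructible f.toEquiv S) :
    Constructible f.toEquiv {x : ι → M | ∃ y, (fun o : Option ι => o.elim y x) ∈ S} := by
  convert! hS.image_comp some using 1
  ext x
  constructor
  · rintro ⟨y, hy⟩
    exact ⟨_, hy, rfl⟩
  · rintro ⟨z, hz, rfl⟩
    refine ⟨z none, ?_⟩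
    convert! hz using 1
    funext o
    cases o <;> rfl

theorem constructible_eq (f : AcyclicPairing n M) [Nonempty M] [Finite ι]
    (s t : Tree n (ι ⊕ M)) : Constructible f.toEquiv
      {x : ι → M | s.eval f.toEquiv (Sum.elim x id) = t.eval f.toEquiv (Sum.elim x id)} := by
  convert! (isClosedSet_solutions f [(s, t)]).constructible using 1
  ext x
  simp [solutions]

/-- Trees contain only the inverse of `f`, so its components are introduced as `n` auxiliary
coordinates and projected away. -/
theorem constructible_eq_apply (f : AcyclicPairing n M) [Nonempty M] [Finite ι] (i j : ι)
    (a : Fin n) : Constructible f.toEquiv {x : ι → M | x j = f.toEquiv (x i) a} := by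
  have h1 := constructible_eq (ι := ι ⊕ Fin n) f (.leaf (.inl (.inl i)))
    (.node fun b => .leaf (.inl (.inr b)))
  have h2 := constructible_eq (ι := ι ⊕ Fin n) f (.leaf (.inl (.inl j)))
    (.leaf (.inl (.inr a)))
  convert! (h1.inter h2).image_comp Sum.inl using 1
  ext x
  constructor
  · intro hx
    refine ⟨Sum.elim x (f.toEquiv (x i)), ⟨?_, hx⟩, rfl⟩
    exact (f.toEquiv.symm_apply_apply (x i)).symm
  · rintro ⟨y, ⟨hy1, hy2⟩, rfl⟩
    simp only [Set.mem_ofPred_eq, Tree.eval, Sum.elim_inl] at hy1 hy2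
    simp only [Set.mem_ofPred_eq, Function.comp_apply, hy1, hy2, Equiv.apply_symm_apply]

end Constructible

/-! ### Quantifier elimination -/

section Definable

open FirstOrder FirstOrder.Language

variable {n : ℕ} {M : Type w} [(unaryLang n).Structure M] {ι : Type}

/-- An extra coordinate carries the value of the argument of the outermost symbol; parameter
constants become leaves. -/
theorem constructible_eq_term (f : AcyclicPairing n M)
    (hf : ∀ x i, f.toEquiv x i = op i x) [Nonempty M] {A : Type} [Finite ι]
    (t : (unaryLang n)[[(univ : Set M)]].Term A) (g : A → ι) (j : ι) :
    Constructible f.toEquiv {x : ι → M | x j = t.realize (x ∘ g)} := by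
  induction t generalizing ι with
  | var a => exact constructible_eq f (.leaf (.inl j)) (.leaf (.inl (g a)))
  | @func l F ts ih =>
    rcases F with F | F
    · obtain ⟨i⟩ : UnaryFunc n l := F
      have h1 := ih 0 (some ∘ g) none
      have h2 := constructible_eq_apply f none (some j) i
      convert! (h1.inter h2).exists_option using 1
      ext x
      have hr : Term.realize (x ∘ g) (Term.func (Sum.inl (UnaryFunc.l i) :
          (unaryLang n)[[(univ : Set M)]].Functions 1) ts) =
          op i ((ts 0).realize (x ∘ g)) := by
        simp only [Term.realize, op]
        refine congrArg (Structure.funMap (L := unaryLang n) (UnaryFunc.l i)) ?_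
        funext c
        obtain rfl : c = 0 := Subsingleton.elim _ _
        rfl
      rw [Set.mem_ofPred_eq, hr]
      constructor
      · intro hx
        refine ⟨(ts 0).realize (x ∘ g), ?_, ?_⟩
        · rw [Set.mem_ofPred_eq]
          rfl
        · exact hx.trans (hf _ _).symm
      · rintro ⟨y, hy1, hy2⟩
        have hy1' : y = (ts 0).realize (x ∘ g) := hy1
        have hy2' : x j = f.toEquiv y i := hy2
        rw [hy2', hf, hy1']
    · rcases l with _ | l
      · let c : M := ((F : (univ : Set M)) : M)
        convert! constructible_eq f (.leaf (.inl j)) (.leaf (.inr c)) using 1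
      · exact (IsEmpty.false F).elim

theorem constructible_realize (f : AcyclicPairing n M)
    (hf : ∀ x i, f.toEquiv x i = op i x) [Nonempty M] [Finite ι] {k : ℕ}
    (φ : (unaryLang n)[[(univ : Set M)]].BoundedFormula ι k) :
    Constructible f.toEquiv {x : ι ⊕ Fin k → M | φ.Realize (x ∘ .inl) (x ∘ .inr)} := by
  induction φ with
  | falsum => exact .empty _
  | @equal k t s =>
    have h1 := constructible_eq_term f hf t some none
    have h2 := constructible_eq_term f hf s some none
    convert! (h1.inter h2).exists_option using 1
    ext x
    simp only [BoundedFormula.Realize, Set.mem_ofPred_eq, mem_inter_iff, Sum.elim_comp_inl_inr]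
    constructor
    · intro h
      exact ⟨_, rfl, h⟩
    · rintro ⟨y, h1, h2⟩
      exact h1.symm.trans h2
  | rel R ts =>
    rcases R with R | R
    · exact Empty.elim R
    · exact (IsEmpty.false R).elim
  | imp φ ψ h1 h2 =>
    convert! (h1.inter h2.compl).compl using 1
    ext x
    simp only [BoundedFormula.realize_imp, Set.mem_ofPred_eq, mem_compl_iff, mem_inter_iff]
    tauto
  | @all k φ ih =>
    -- The last bound variable becomes `none`, the coordinate removed by `exists_option`; the
    -- universal quantifier is a negated existential.
    let g : ι ⊕ Fin (k + 1) → Option (ι ⊕ Fin k) :=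
      Sum.elim (fun i => some (.inl i)) (Fin.snoc (fun i => some (.inr i)) none)
    have h := ((ih.compl).preimage_comp g).exists_option.compl
    convert! h using 1
    ext x
    simp only [BoundedFormula.realize_all, Set.mem_ofPred_eq, mem_compl_iff, not_exists, not_not]
    refine forall_congr' fun y => ?_
    have h2 : (((fun o : Option (ι ⊕ Fin k) => o.elim y x) ∘ g) ∘ Sum.inr : Fin (k + 1) → M) =
        Fin.snoc (x ∘ .inr) y := by
      funext i
      refine Fin.lastCases ?_ (fun i => ?_) i
      · simp [g]
      · simp [g]
    rw [h2]
    rfl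

/-- Quantifier elimination: definable sets are constructible. -/
theorem Definable.constructible (f : AcyclicPairing n M)
    (hf : ∀ x i, f.toEquiv x i = op i x) [Nonempty M] [Finite ι] {S : Set (ι → M)}
    (hS : (univ : Set M).Definable (unaryLang n) S) : Constructible f.toEquiv S := by
  obtain ⟨φ, rfl⟩ := hS
  convert! (constructible_realize f hf φ).preimage_comp
    (Sum.elim id Fin.elim0 : ι ⊕ Fin 0 → ι) using 1
  ext x
  have h : (x ∘ (Sum.elim id Fin.elim0 : ι ⊕ Fin 0 → ι)) ∘ Sum.inr = (default : Fin 0 → M) :=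
    Subsingleton.elim _ _
  rw [Set.mem_ofPred_eq, Set.mem_ofPred_eq, Set.mem_ofPred_eq, h]
  rfl

end Definable

/-! ### The Euler characteristic -/

section Euler

variable {n : ℕ} {M : Type w} {V U ι κ : Type} {R : Type*} [CommRing R]

/-- Inclusion-exclusion as an induction: both sets on the right remove one closed set fewer, and the
second is contained in the first. -/
theorem sdiff_sUnion_insert {α : Type*} (D T : Set α) (G : Set (Set α)) :
    D \ ⋃₀ (insert T G) = (D \ ⋃₀ G) \ ((D ∩ T) \ ⋃₀ G) := by
  ext x
  simp only [sUnion_insert, mem_sdiff, mem_union, mem_inter_iff]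
  tauto

/-- The integral indicator function of a cell. -/
noncomputable def cellIndicator (f : M ≃ (Fin n → M)) (ι : Type)
    (B : {B : Set (ι → M) // ∃ k, IsCell f k B}) : (ι → M) → ℤ := B.1.indicator 1

/-- Among the cells with nonzero coefficient, a maximal one is not covered by the others, by
irreducibility. At an uncovered point of it the relation reduces to its own coefficient. -/
theorem linearIndependent_cellIndicator (f : AcyclicPairing n M) [Nonempty M] (ι : Type)
    [Finite ι] : LinearIndependent ℤ (cellIndicator f.toEquiv ι) := by
  classical
  rw [linearIndependent_iff']
  intro s g hg
  by_contra! hne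
  obtain ⟨B₀, hB₀, hgB₀⟩ := hne
  let s' := s.filter fun B => g B ≠ 0
  obtain ⟨B, hB, hmax⟩ := s'.exists_maximal ⟨B₀, Finset.mem_filter.2 ⟨hB₀, hgB₀⟩⟩
  rw [Finset.mem_filter] at hB
  have hx : ∃ x ∈ B.1, ∀ A ∈ s', A ≠ B → x ∉ A.1 := by
    by_contra! h
    obtain ⟨k, hk⟩ := B.2
    obtain ⟨_, ⟨A, hA, rfl⟩, hBA⟩ := hk.subset_of_subset_sUnion (f := f)
      (F := (fun A => A.1) '' {A | A ∈ s' ∧ A ≠ B})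
      ((s'.finite_toSet.subset fun A hA => hA.1).image _) (by
        rintro _ ⟨A, -, rfl⟩
        exact Or.inr A.2) (by
        intro x hx
        obtain ⟨A, hA, hne, hxA⟩ := h x hx
        exact ⟨_, ⟨A, ⟨hA, hne⟩, rfl⟩, hxA⟩)
    exact hA.2 (le_antisymm (hmax hA.1 hBA) hBA)
  obtain ⟨x, hxB, hx⟩ := hx
  have h0 := congrFun hg x
  rw [Finset.sum_apply, Finset.sum_eq_single B] at h0
  · rw [Pi.smul_apply, cellIndicator, indicator_of_mem hxB] at h0
    exact hB.2 (by simpa using h0)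
  · intro A hA hne
    by_cases hgA : g A = 0
    · simp [hgA]
    · rw [Pi.smul_apply, cellIndicator,
        indicator_of_notMem (hx A (Finset.mem_filter.2 ⟨hA, hgA⟩) hne), smul_zero]
  · exact fun h => absurd hB.1 h

/-- The group of integral constructible functions. -/
noncomputable abbrev cellSpan (f : M ≃ (Fin n → M)) (ι : Type) : Submodule ℤ ((ι → M) → ℤ) :=
  Submodule.span ℤ (range (cellIndicator f ι))

/-- The linear map sending the indicator function of a cell of dimension `k` to `r ^ k`. -/
noncomputable def eulerMap (f : AcyclicPairing n M) [Nonempty M] (r : R) (ι : Type) [Finite ι] :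
    cellSpan f.toEquiv ι →ₗ[ℤ] R :=
  (Module.Basis.span (linearIndependent_cellIndicator f ι)).constr ℤ fun B => r ^ B.2.choose

theorem IsCell.indicator_mem {f : M ≃ (Fin n → M)} {k : ℕ} {B : Set (ι → M)}
    (h : IsCell f k B) : B.indicator 1 ∈ cellSpan f ι :=
  Submodule.subset_span ⟨⟨B, k, h⟩, rfl⟩

theorem eulerMap_indicator (f : AcyclicPairing n M) [Nonempty M] {r : R} (hr : r ^ n = r)
    [Finite ι] {k : ℕ} {B : Set (ι → M)} (h : IsCell f.toEquiv k B) :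
    eulerMap f r ι ⟨B.indicator 1, h.indicator_mem⟩ = r ^ k := by
  let B' : {B : Set (ι → M) // ∃ k, IsCell f.toEquiv k B} := ⟨B, k, h⟩
  have h1 : (⟨B.indicator 1, h.indicator_mem⟩ : cellSpan f.toEquiv ι) =
      Module.Basis.span (linearIndependent_cellIndicator f ι) B' :=
    (Module.Basis.span_apply (linearIndependent_cellIndicator f ι) B').symm
  rw [h1, eulerMap, Module.Basis.constr_basis]
  -- The dimension chosen in `eulerMap` need not be `k`; only its power of `r` is determined.
  exact IsCell.pow_eq hr B'.2.choose_spec h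

theorem Constructible.indicator_mem {f : AcyclicPairing n M} [Nonempty M] [Finite ι]
    {S : Set (ι → M)} (hS : Constructible f.toEquiv S) :
    S.indicator 1 ∈ cellSpan f.toEquiv ι := by
  refine Constructible.induction (f := f)
    (P := fun S => S.indicator 1 ∈ cellSpan f.toEquiv ι) ?_ ?_ ?_ hS
  · rw [indicator_empty']
    exact zero_mem _
  · intro D hD G hG hc
    induction G, hG using Set.Finite.induction_on generalizing D with
    | empty =>
      rw [sUnion_empty, sdiff_empty]
      rcases hD with rfl | ⟨k, hD⟩
      · rw [indicator_empty']
        exact zero_mem _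
      · exact hD.indicator_mem
    | @insert T G _ _ ih =>
      have hc' : ∀ A ∈ G, IsClosedSet f.toEquiv A := fun A hA => hc A (mem_insert_of_mem _ hA)
      rw [sdiff_sUnion_insert, indicator_sdiff
        (show (D ∩ T) \ ⋃₀ G ⊆ D \ ⋃₀ G from fun x hx => ⟨hx.1.1, hx.2⟩)]
      exact sub_mem (ih D hD hc') (ih _ (hD.inter (hc T (mem_insert _ _))) hc')
  · intro S T _ _ hd h1 h2
    rw [indicator_union_of_disjoint hd]
    exact add_mem h1 h2

open Classical in
/-- The Euler characteristic of a constructible set. -/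
noncomputable def euler (f : AcyclicPairing n M) [Nonempty M] (r : R) [Finite ι]
    (S : Set (ι → M)) : R :=
  -- The value `0` is a default, never used for constructible sets.
  if h : S.indicator 1 ∈ cellSpan f.toEquiv ι then eulerMap f r ι ⟨S.indicator 1, h⟩ else 0

theorem Constructible.euler_eq {f : AcyclicPairing n M} [Nonempty M] [Finite ι] {S : Set (ι → M)}
    (hS : Constructible f.toEquiv S) (r : R) :
    euler f r S = eulerMap f r ι ⟨S.indicator 1, hS.indicator_mem⟩ :=
  dif_pos hS.indicator_mem

theorem euler_cell (f : AcyclicPairing n M) [Nonempty M] {r : R} (hr : r ^ n = r) [Finite ι]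
    {k : ℕ} {B : Set (ι → M)} (h : IsCell f.toEquiv k B) : euler f r B = r ^ k := by
  rw [Constructible.euler_eq (IsClosedSet.constructible (Or.inr ⟨k, h⟩))]
  exact eulerMap_indicator f hr h

theorem euler_empty (f : AcyclicPairing n M) [Nonempty M] (r : R) [Finite ι] :
    euler f r (∅ : Set (ι → M)) = 0 := by
  rw [(Constructible.empty f.toEquiv).euler_eq]
  convert! map_zero (eulerMap f r ι) using 2
  exact Subtype.ext (indicator_empty _)

theorem Constructible.euler_union {f : AcyclicPairing n M} [Nonempty M] [Finite ι]
    {S T : Set (ι → M)} (hS : Constructible f.toEquiv S) (hT : Constructible f.toEquiv T)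
    (hd : Disjoint S T) (r : R) : euler f r (S ∪ T) = euler f r S + euler f r T := by
  rw [hS.euler_eq, hT.euler_eq, (hS.union hT).euler_eq, ← map_add]
  congr 1
  exact Subtype.ext (indicator_union_of_disjoint hd _)

theorem euler_iUnion (f : AcyclicPairing n M) [Nonempty M] [Finite ι] {α : Type*} [Fintype α]
    {S : α → Set (ι → M)} (hS : ∀ a, Constructible f.toEquiv (S a))
    (hd : ∀ a b, a ≠ b → Disjoint (S a) (S b)) (r : R) :
    euler f r (⋃ a, S a) = ∑ a, euler f r (S a) := by
  classical
  have h : ∀ s : Finset α, euler f r (⋃ a ∈ s, S a) = ∑ a ∈ s, euler f r (S a) := by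
    intro s
    induction s using Finset.induction_on with
    | empty => simp [euler_empty]
    | insert a s ha ih =>
      rw [Finset.set_biUnion_insert, Constructible.euler_union (hS a), ih, Finset.sum_insert ha]
      · exact Constructible.biUnion s.finite_toSet fun b _ => hS b
      · rw [disjoint_iUnion₂_right]
        rintro b hb
        exact hd a b fun hab => ha (hab ▸ hb)
  simpa using h Finset.univ

theorem extend_indicator {α β : Type*} {φ : α → β} (hφ : Injective φ) (S : Set α) :
    extend φ (S.indicator (1 : α → ℤ)) 0 = (φ '' S).indicator 1 := by
  classical
  funext y
  by_cases hy : ∃ x, φ x = y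
  · obtain ⟨x, rfl⟩ := hy
    rw [hφ.extend_apply]
    by_cases hx : x ∈ S
    · rw [indicator_of_mem hx, indicator_of_mem (mem_image_of_mem _ hx)]
      rfl
    · rw [indicator_of_notMem hx, indicator_of_notMem]
      rwa [hφ.mem_set_image]
  · rw [extend_apply' _ _ _ hy, indicator_of_notMem]
    · rfl
    · rintro ⟨x, -, rfl⟩
      exact hy ⟨x, rfl⟩

/-- Extension by zero along the tree map is linear and sends the indicator of a cell to that of a
cell of the same dimension, so the claim holds on the span of the cells. -/
theorem Constructible.euler_image {f : AcyclicPairing n M} [Nonempty M] [Finite ι] [Finite V]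
    {r : R} (hr : r ^ n = r) {S : Set (V → M)} (hS : Constructible f.toEquiv S)
    {σ : ι → Tree n (V ⊕ M)} (hσ : Injective (polyMap f.toEquiv id σ)) :
    euler f r (polyMap f.toEquiv id σ '' S) = euler f r S := by
  let X := Function.ExtendByZero.linearMap ℤ (polyMap f.toEquiv id σ)
  have hX : ∀ S : Set (V → M), X (S.indicator 1) = (polyMap f.toEquiv id σ '' S).indicator 1 :=
    fun S => extend_indicator hσ S
  have key : ∀ a (ha : a ∈ cellSpan f.toEquiv V), ∃ h : X a ∈ cellSpan f.toEquiv ι,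
      eulerMap f r ι ⟨X a, h⟩ = eulerMap f r V ⟨a, ha⟩ := by
    intro a ha
    induction ha using Submodule.span_induction with
    | mem a h =>
      obtain ⟨⟨B, k, hB⟩, rfl⟩ := h
      have hB' := hB.image hσ
      refine ⟨?_, ?_⟩
      · rw [cellIndicator, hX]
        exact hB'.indicator_mem
      · have h1 := eulerMap_indicator f hr hB
        have h2 := eulerMap_indicator f hr hB'
        refine Eq.trans ?_ (h2.trans h1.symm)
        congr 1
        exact Subtype.ext (hX B)
    | zero =>
      refine ⟨by simp, ?_⟩
      have h1 := map_zero (eulerMap f r ι)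
      have h2 := map_zero (eulerMap f r V)
      refine Eq.trans ?_ (h1.trans h2.symm)
      congr 1
      exact Subtype.ext (map_zero X)
    | add a b ha hb iha ihb =>
      obtain ⟨ha', ea⟩ := iha
      obtain ⟨hb', eb⟩ := ihb
      refine ⟨by rw [map_add]; exact add_mem ha' hb', ?_⟩
      have h1 := map_add (eulerMap f r ι) ⟨_, ha'⟩ ⟨_, hb'⟩
      have h2 := map_add (eulerMap f r V) ⟨_, ha⟩ ⟨_, hb⟩
      rw [ea, eb, ← h2] at h1
      refine Eq.trans ?_ h1
      congr 1
      exact Subtype.ext (map_add X a b)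
    | smul c a ha iha =>
      obtain ⟨ha', ea⟩ := iha
      refine ⟨by rw [map_smul]; exact Submodule.smul_mem _ c ha', ?_⟩
      have h1 := map_smul (eulerMap f r ι) c ⟨_, ha'⟩
      have h2 := map_smul (eulerMap f r V) c ⟨_, ha⟩
      rw [ea, ← h2] at h1
      refine Eq.trans ?_ h1
      congr 1
      exact Subtype.ext (map_smul X c a)
  obtain ⟨h, e⟩ := key _ hS.indicator_mem
  rw [hS.euler_eq, (hS.image hσ).euler_eq, ← e]
  congr 1
  exact Subtype.ext (hX S).symm

/-- If a coordinate projection is injective on a nonempty open part of a cell, then it is injective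
on the cell. -/
theorem injective_polyMap_of_injOn {f : AcyclicPairing n M} [Nonempty M] [Finite V] [Finite ι]
    {σ : ι → Tree n (V ⊕ M)} {τ : κ → Tree n (V ⊕ M)}
    {G : Set (Set (ι → M))} (hG : G.Finite) (hc : ∀ T ∈ G, IsClosedSet f.toEquiv T)
    (hinj : ∀ z z', polyMap f.toEquiv id σ z ∉ ⋃₀ G → polyMap f.toEquiv id σ z' ∉ ⋃₀ G →
      polyMap f.toEquiv id τ z = polyMap f.toEquiv id τ z' → z = z')
    {z : V → M} (hz : polyMap f.toEquiv id σ z ∉ ⋃₀ G) : Injective (polyMap f.toEquiv id τ) := by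
  classical
  obtain ⟨τ', hτ, hτi⟩ := exists_factor f.toEquiv τ
  by_cases hp : ∀ v, ∃ i, (τ i).Mem (.inl v)
  · intro x y hxy
    rw [hτ, hτ] at hxy
    funext v
    exact congrFun (hτi hxy) ⟨v, hp v⟩
  · rw [not_forall] at hp
    obtain ⟨u, hu⟩ := hp
    -- The line through `z` in the direction of a variable `u` absent from `τ`: moving along it does
    -- not change the value of `τ`.
    let α : V → Tree n (Unit ⊕ M) := fun v =>
      if v = u then .leaf (.inl ()) else .leaf (.inr (z v))
    have hα : ∀ y, polyMap f.toEquiv id α y = update z u (y ()) := by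
      intro y
      funext v
      by_cases hv : v = u
      · subst hv
        simp [polyMap, α, Tree.eval]
      · simp [polyMap, α, Tree.eval, hv]
    have hout : ∃ y : Unit → M, polyMap f.toEquiv id σ (polyMap f.toEquiv id α y) ∉ ⋃₀ G ∧
        y () ≠ z u := by
      -- Otherwise the line is covered by the point `z u` and the preimages of `G`. By
      -- irreducibility one of these is the whole line, but `M` is infinite and `z` lies in no
      -- preimage.
      by_contra! h
      let E : List (Tree n (Unit ⊕ M) × Tree n (Unit ⊕ M)) :=
        [(.leaf (.inl ()), .leaf (.inr (z u)))]
      have hE : ∀ y, y ∈ solutions f.toEquiv E ↔ y () = z u := by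
        intro y
        simp [solutions, E, Tree.eval]
      have := univ_mem_of_sUnion_eq_univ (f := f) (F := insert (solutions f.toEquiv E)
        ((fun T => polyMap f.toEquiv id α ⁻¹' (polyMap f.toEquiv id σ ⁻¹' T)) '' G))
        ((hG.image _).insert _) (by
          rintro _ (rfl | ⟨T, hT, rfl⟩)
          · exact isClosedSet_solutions f E
          · exact ((hc T hT).preimage σ).preimage α) (eq_univ_of_forall fun y => by
          by_cases hy : polyMap f.toEquiv id σ (polyMap f.toEquiv id α y) ∈ ⋃₀ G
          · obtain ⟨T, hT, hy⟩ := hy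
            exact ⟨_, mem_insert_of_mem _ ⟨T, hT, rfl⟩, hy⟩
          · exact ⟨_, mem_insert _ _, (hE y).2 (h y hy)⟩)
      rcases this with h1 | ⟨T, hT, h1⟩
      · have := f.infinite
        obtain ⟨b, hb⟩ := exists_ne (z u)
        exact hb ((hE fun _ => b).1 (h1 ▸ mem_univ _))
      · refine hz ⟨T, hT, ?_⟩
        have h2 : polyMap f.toEquiv id σ (polyMap f.toEquiv id α fun _ => z u) ∈ T :=
          eq_univ_iff_forall.1 h1 fun _ => z u
        rwa [hα, update_eq_self] at h2
    obtain ⟨y, hy, hne⟩ := hout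
    have h1 := hinj z (polyMap f.toEquiv id α y) hz hy (by
      rw [hτ, hτ, hα]
      congr 1
      funext v
      have hv : v.1 ≠ u := fun h => hu (h ▸ v.2)
      rw [update_of_ne hv])
    rw [hα] at h1
    have h2 := congrFun h1 u
    rw [update_self] at h2
    exact absurd h2.symm hne

/-- The Euler characteristic is invariant under injective coordinate projections. -/
theorem Constructible.euler_image_comp {f : AcyclicPairing n M} [Nonempty M] [Finite ι] [Finite κ]
    {r : R} (hr : r ^ n = r) {S : Set (ι → M)} (hS : Constructible f.toEquiv S) (g : κ → ι)
    (hinj : InjOn (fun x : ι → M => x ∘ g) S) :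
    euler f r ((fun x : ι → M => x ∘ g) '' S) = euler f r S := by
  revert hinj
  refine Constructible.induction (f := f) (P := fun S => InjOn (fun x : ι → M => x ∘ g) S →
    euler f r ((fun x : ι → M => x ∘ g) '' S) = euler f r S) ?_ ?_ ?_ hS
  · intro
    rw [image_empty, euler_empty, euler_empty]
  · intro D hD G hG hc hinj
    rcases eq_empty_or_nonempty (D \ ⋃₀ G) with h0 | ⟨x, hx⟩
    · rw [h0, image_empty, euler_empty, euler_empty]
    rcases hD with rfl | ⟨k, V, _, σ, -, hσ, rfl⟩
    · exact hx.1.elim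
    obtain ⟨⟨z, rfl⟩, hz⟩ := hx
    -- Then the open part of the cell and its projection are images of the same parameter set under
    -- two injective tree maps.
    have hτ : Injective (polyMap f.toEquiv id (σ ∘ g)) :=
      injective_polyMap_of_injOn hG hc
        (fun z z' hz hz' h => hσ (hinj ⟨⟨z, rfl⟩, hz⟩ ⟨⟨z', rfl⟩, hz'⟩ h)) hz
    have hcon : Constructible f.toEquiv
        (polyMap f.toEquiv id σ ⁻¹' (range (polyMap f.toEquiv id σ) \ ⋃₀ G)) :=
      (diff_sUnion (Or.inr ⟨_, isCell_range _ hσ⟩) hG hc).preimage σ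
    have h1 := hcon.euler_image hr hσ
    have h2 := hcon.euler_image hr hτ
    rw [image_preimage_eq_of_subset sdiff_subset] at h1
    rw [h1, ← h2]
    congr 1
    conv_lhs => rw [← image_preimage_eq_of_subset (f := polyMap f.toEquiv id σ)
      (s := range (polyMap f.toEquiv id σ) \ ⋃₀ G) sdiff_subset, image_image]
    rfl
  · intro S T hS hT hd h1 h2 hinj
    rw [image_union, (hS.image_comp g).euler_union (hT.image_comp g), hS.euler_union hT hd,
      h1 (hinj.mono subset_union_left), h2 (hinj.mono subset_union_right)]
    rw [Set.disjoint_left]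
    rintro _ ⟨x, hx, rfl⟩ ⟨y, hy, hxy⟩
    obtain rfl := hinj (Or.inr hy) (Or.inl hx) hxy
    exact disjoint_left.1 hd hx hy

end Euler

/-! ### Descent of the Euler characteristic to the Grothendieck ring -/

section EulerK0

open FirstOrder

variable {n : ℕ} {M : Type w} [Nonempty M] [(unaryLang n).Structure M] {R : Type*} [CommRing R]

/-- Both projections are injective on each piece `graph e i j`, and their images partition the
pieces of `F` and of `G`. Hence both sides are the same double sum over the graph pieces. -/
theorem DefEquiv.sum_euler_eq (f : AcyclicPairing n M) (hf : ∀ x i, f.toEquiv x i = op i x)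
    {r : R} (hr : r ^ n = r) {ι κ : Type} [Fintype ι] [Fintype κ]
    {F : ι → DefSet (unaryLang n) M} {G : κ → DefSet (unaryLang n) M} (h : DefEquiv F G) :
    ∑ i, euler f r (F i).carrier = ∑ j, euler f r (G j).carrier := by
  obtain ⟨e, he⟩ := h
  have hc : ∀ i j, Constructible f.toEquiv (graph e i j) :=
    fun i j => Definable.constructible f hf (he i j)
  have hl : ∀ i, euler f r (F i).carrier = ∑ j, euler f r (graph e i j) := by
    intro i
    have hU : (F i).carrier = ⋃ j, (fun z => z ∘ Sum.inl) '' graph e i j := by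
      ext x
      rw [mem_iUnion]
      constructor
      · intro hx
        rcases hy : e ⟨i, x, hx⟩ with ⟨j, y, hyj⟩
        exact ⟨j, Sum.elim x y, ⟨hx, hyj, hy⟩, rfl⟩
      · rintro ⟨j, z, ⟨hx, -⟩, rfl⟩
        exact hx
    rw [hU, euler_iUnion f (fun j => (hc i j).image_comp Sum.inl)]
    · refine Finset.sum_congr rfl fun j _ => (hc i j).euler_image_comp hr Sum.inl ?_
      rintro z ⟨hx, hy, h⟩ z' ⟨hx', hy', h'⟩ (hz : z ∘ Sum.inl = z' ∘ Sum.inl)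
      have h1 : (⟨i, _, hx⟩ : Total F) = ⟨i, _, hx'⟩ := by
        congr 2
      rw [h1, h'] at h
      have h2 : z' ∘ Sum.inr = z ∘ Sum.inr :=
        congrArg Subtype.val (eq_of_heq (Sigma.mk.inj h).2)
      rw [← Sum.elim_comp_inl_inr z, ← Sum.elim_comp_inl_inr z', hz, h2]
    · intro j j' hj
      rw [Set.disjoint_left]
      rintro _ ⟨z, ⟨hx, hy, h⟩, rfl⟩ ⟨z', ⟨hx', hy', h'⟩, hz⟩
      have hz : z' ∘ Sum.inl = z ∘ Sum.inl := hz
      have h1 : (⟨i, _, hx⟩ : Total F) = ⟨i, _, hx'⟩ := by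
        congr 2
        exact hz.symm
      rw [h1, h'] at h
      exact hj (congrArg Sigma.fst h).symm
  have hr' : ∀ j, euler f r (G j).carrier = ∑ i, euler f r (graph e i j) := by
    intro j
    have hU : (G j).carrier = ⋃ i, (fun z => z ∘ Sum.inr) '' graph e i j := by
      ext y
      rw [mem_iUnion]
      constructor
      · intro hy
        rcases hx : e.symm ⟨j, y, hy⟩ with ⟨i, x, hxi⟩
        exact ⟨i, Sum.elim x y, ⟨hxi, hy, ((e.symm_apply_eq).1 hx).symm⟩, rfl⟩
      · rintro ⟨i, z, ⟨-, hy, -⟩, rfl⟩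
        exact hy
    rw [hU, euler_iUnion f (fun i => (hc i j).image_comp Sum.inr)]
    · refine Finset.sum_congr rfl fun i _ => (hc i j).euler_image_comp hr Sum.inr ?_
      rintro z ⟨hx, hy, h⟩ z' ⟨hx', hy', h'⟩ (hz : z ∘ Sum.inr = z' ∘ Sum.inr)
      have h1 : (⟨j, _, hy⟩ : Total G) = ⟨j, _, hy'⟩ := by
        congr 2
      rw [h1, ← h'] at h
      have h2 : z ∘ Sum.inl = z' ∘ Sum.inl :=
        congrArg Subtype.val (eq_of_heq (Sigma.mk.inj (e.injective h)).2)
      rw [← Sum.elim_comp_inl_inr z, ← Sum.elim_comp_inl_inr z', hz, h2]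
    · intro i i' hi
      rw [Set.disjoint_left]
      rintro _ ⟨z, ⟨hx, hy, h⟩, rfl⟩ ⟨z', ⟨hx', hy', h'⟩, hz⟩
      have hz : z' ∘ Sum.inr = z ∘ Sum.inr := hz
      have h1 : (⟨j, _, hy⟩ : Total G) = ⟨j, _, hy'⟩ := by
        congr 2
        exact hz.symm
      rw [h1, ← h'] at h
      exact hi (congrArg Sigma.fst (e.injective h))
  simp only [hl, hr']
  exact Finset.sum_comm

/-- The Euler characteristic as an additive map on the Grothendieck semiring. -/
noncomputable def eulerSemiring (f : AcyclicPairing n M) (hf : ∀ x i, f.toEquiv x i = op i x)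
    {r : R} (hr : r ^ n = r) : K0Semiring (unaryLang n) M →+ R where
  toFun := Quotient.lift (fun a : DefUnion (unaryLang n) M => ∑ i, euler f r (a.piece i).carrier)
    fun _ _ h => h.sum_euler_eq f hf hr
  map_zero' := Finset.sum_empty
  map_add' := by
    rintro ⟨a⟩ ⟨b⟩
    refine ((a.add_equiv b).sum_euler_eq f hf hr).trans ?_
    rw [Fintype.sum_sum_type]
    rfl

/-- The Euler characteristic as an additive map on the Grothendieck ring. -/
noncomputable def eulerK0 (f : AcyclicPairing n M) (hf : ∀ x i, f.toEquiv x i = op i x)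
    {r : R} (hr : r ^ n = r) : K0 (unaryLang n) M →+ R :=
  RingCompletion.liftAdd (eulerSemiring f hf hr)

theorem eulerK0_pow (f : AcyclicPairing n M) (hf : ∀ x i, f.toEquiv x i = op i x)
    {r : R} (hr : r ^ n = r) (k : ℕ) :
    eulerK0 f hf hr (K0.cls (DefSet.pow (unaryLang n) M k)) = r ^ k := by
  rw [eulerK0, K0.cls, RingCompletion.liftAdd_of]
  have h : eulerSemiring f hf hr (K0Semiring.mk (.single (.pow (unaryLang n) M k))) =
      ∑ _i : Fin 1, euler f r (univ : Set (Fin k → M)) := rfl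
  rw [h, Fin.sum_univ_one, euler_cell f hr (isCell_univ f.toEquiv), Fintype.card_fin]

end EulerK0

/-! ### Calculus of classes in the Grothendieck ring -/

section Classes

open FirstOrder FirstOrder.Language

variable {L : FirstOrder.Language.{u, v}} {M : Type w} [L.Structure M]

/-- A definable set that is partitioned into finitely many definable sets is in definable bijection
with their disjoint union. -/
theorem DefEquiv.of_partition {ι : Type} {d : ℕ} {S : ι → Set (Fin d → M)}
    (hS : ∀ i, (univ : Set M).Definable L (S i)) {T : Set (Fin d → M)}
    (hT : (univ : Set M).Definable L T) (hU : T = ⋃ i, S i)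
    (hd : ∀ i j x, x ∈ S i → x ∈ S j → i = j) :
    DefEquiv (fun i => (⟨d, S i, hS i⟩ : DefSet L M)) (fun _ : Fin 1 => ⟨d, T, hT⟩) := by
  subst hU
  let φ : Total (fun i => (⟨d, S i, hS i⟩ : DefSet L M)) →
      Total (fun _ : Fin 1 => (⟨d, ⋃ i, S i, hT⟩ : DefSet L M)) :=
    fun z => ⟨0, z.2.1, mem_iUnion.2 ⟨z.1, z.2.2⟩⟩
  have hφ : Bijective φ := by
    constructor
    · rintro ⟨i, x, hx⟩ ⟨j, y, hy⟩ h
      have h1 : x = y := congrArg Subtype.val (eq_of_heq (Sigma.mk.inj h).2)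
      subst h1
      obtain rfl := hd i j x hx hy
      rfl
    · rintro ⟨j, y, hy⟩
      obtain rfl : j = 0 := Subsingleton.elim _ _
      obtain ⟨i, hi⟩ := mem_iUnion.1 hy
      exact ⟨⟨i, y, hi⟩, rfl⟩
  refine ⟨Equiv.ofBijective φ hφ, fun i j => ?_⟩
  obtain rfl : j = 0 := Subsingleton.elim _ _
  have h1 : (univ : Set M).Definable L {z : Fin d ⊕ Fin d → M |
      ∀ c, z (Sum.inl c) = z (Sum.inr c)} := by
    rw [Set.ofPred_forall]
    exact definable_iInter_of_finite fun c =>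
      (DefinableFun.proj L).ofPred_eq (DefinableFun.proj L)
  convert! ((hS i).preimage_comp (Sum.inl : Fin d → Fin d ⊕ Fin d)).inter h1 using 1
  ext z
  constructor
  · rintro ⟨hx, hy, h⟩
    exact ⟨hx, fun c => congrFun (congrArg Subtype.val (eq_of_heq (Sigma.mk.inj h).2)) c⟩
  · rintro ⟨hx, h⟩
    have h' : z ∘ Sum.inl = z ∘ Sum.inr := funext h
    have hx' : z ∘ Sum.inl ∈ ⋃ i, S i := mem_iUnion.2 ⟨i, hx⟩
    exact ⟨hx, h' ▸ hx', congrArg (Sigma.mk 0) (Subtype.ext h')⟩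

theorem cls_union {d : ℕ} {S T : Set (Fin d → M)} (hS : (univ : Set M).Definable L S)
    (hT : (univ : Set M).Definable L T) (hd : Disjoint S T) :
    K0.cls (⟨d, S ∪ T, hS.union hT⟩ : DefSet L M) = K0.cls ⟨d, S, hS⟩ + K0.cls ⟨d, T, hT⟩ := by
  rw [K0.cls, K0.cls, K0.cls, ← map_add]
  congr 1
  refine (K0Semiring.mk_eq_mk _ (DefUnion.add _ _)).2 ?_
  refine DefEquiv.symm ((DefUnion.add_equiv _ _).trans ?_)
  have hSum : ∀ i : Fin 1 ⊕ Fin 1, (univ : Set M).Definable L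
      (Sum.elim (fun _ => S) (fun _ => T) i) := by
    rintro (i | i)
    · exact hS
    · exact hT
  convert! DefEquiv.of_partition hSum (hS.union hT) ?_ ?_ using 1
  · funext i
    rcases i with i | i <;> rfl
  · ext x
    simp
  · rintro (i | i) (j | j) x hx hx'
    · rw [Subsingleton.elim i j]
    · exact (disjoint_left.1 hd hx hx').elim
    · exact (disjoint_left.1 hd hx' hx).elim
    · rw [Subsingleton.elim i j]

/-- Additivity on `∅ = ∅ ∪ ∅` gives `x = x + x`. -/
theorem cls_empty (d : ℕ) : K0.cls (⟨d, ∅, definable_empty⟩ : DefSet L M) = 0 := by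
  have h := cls_union (L := L) (M := M) (d := d) definable_empty definable_empty
    (disjoint_empty ∅)
  simpa using h

theorem cls_sdiff {d : ℕ} {S T : Set (Fin d → M)} (hS : (univ : Set M).Definable L S)
    (hT : (univ : Set M).Definable L T) (h : T ⊆ S) :
    K0.cls (⟨d, S \ T, hS.sdiff hT⟩ : DefSet L M) = K0.cls ⟨d, S, hS⟩ - K0.cls ⟨d, T, hT⟩ := by
  have h1 := cls_union (hS.sdiff hT) hT disjoint_sdiff_left
  rw [eq_sub_iff_add_eq, ← h1]
  congr 2
  exact sdiff_union_of_subset h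

theorem cls_pow_succ (k : ℕ) : K0.cls (DefSet.pow L M (k + 1)) =
    K0.cls (DefSet.pow L M k) * K0.cls (DefSet.pow L M 1) := by
  rw [K0.cls, K0.cls, K0.cls, ← RingCompletion.of_mul]
  congr 1
  refine (K0Semiring.mk_eq_mk _ (DefUnion.mul _ _)).2 ?_
  refine DefEquiv.trans ?_ (DefUnion.mul_equiv _ _).symm
  exact DefEquiv.of_pieces (G := prodFam (fun _ : Fin 1 => DefSet.pow L M k)
    (fun _ : Fin 1 => DefSet.pow L M 1)) (Equiv.uniqueProd (Fin 1) (Fin 1)).symm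
    (fun _ => Equiv.refl _) fun _ _ => iff_of_true (mem_univ _) ⟨mem_univ _, mem_univ _⟩

theorem cls_pow (k : ℕ) : K0.cls (DefSet.pow L M k) = K0.cls (DefSet.pow L M 1) ^ k := by
  induction k with
  | zero => rfl
  | succ k ih => rw [cls_pow_succ, ih, pow_succ]

theorem of_mk_mem {A : AddSubmonoid (K0 L M)} (h : ∀ B : DefSet L M, K0.cls B ∈ A)
    (a : DefUnion L M) : RingCompletion.of (K0Semiring.mk a) ∈ A := by
  obtain ⟨m, p⟩ := a
  induction m with
  | zero =>
    have h0 : (K0Semiring.mk ⟨0, p⟩ : K0Semiring L M) = 0 :=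
      (K0Semiring.mk_eq_mk _ _).2 (DefEquiv.of_isEmpty (ι := Fin 0) (κ := Fin 0) _ _)
    rw [h0, map_zero]
    exact zero_mem A
  | succ m ih =>
    have h1 : K0Semiring.mk ⟨m + 1, p⟩ = K0Semiring.mk ⟨m, p ∘ Fin.castAdd 1⟩ +
        K0Semiring.mk (.single (p (Fin.natAdd m 0))) := by
      refine (K0Semiring.mk_eq_mk _ (DefUnion.add _ _)).2 ?_
      refine DefEquiv.trans ?_ (DefUnion.add_equiv _ _).symm
      convert! (DefEquiv.reindex p finSumFinEquiv).symm using 1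
      funext i
      rcases i with i | i
      · rfl
      · obtain rfl : i = (0 : Fin 1) := Subsingleton.elim (α := Fin 1) _ _
        rfl
    rw [h1, map_add]
    exact add_mem (ih _) (h _)

theorem eq_top_of_cls_mem {A : Subring (K0 L M)} (h : ∀ B : DefSet L M, K0.cls B ∈ A) :
    A = ⊤ := by
  refine eq_top_iff.2 fun x _ => ?_
  obtain ⟨a, b, rfl⟩ := RingCompletion.exists_sub x
  have key : ∀ a : K0Semiring L M, RingCompletion.of a ∈ A := by
    rintro ⟨a⟩
    exact of_mk_mem (A := A.toAddSubgroup.toAddSubmonoid) h a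
  exact sub_mem (key a) (key b)

end Classes

/-! ### Classes of cells and generation by `[M]` -/

section CellClasses

open FirstOrder FirstOrder.Language

variable {n : ℕ} {M : Type w} [(unaryLang n).Structure M]

theorem definableFun_op {ι : Type} [Finite ι] (i : Fin n) (j : ι) :
    (univ : Set M).DefinableFun (unaryLang n) fun z : ι → M => op i (z j) := by
  have h := (Term.func (L := unaryLang n) (UnaryFunc.l i)
    ![Term.var j]).definableFun_realize (M := M)
  refine DefinableFun.of_empty ?_
  convert! h using 1
  funext z
  simp only [op, Term.realize]
  congr 1
  funext c
  obtain rfl : c = 0 := Subsingleton.elim _ _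
  rfl

/-- The inverse of `f` is not a term, but its graph is that of `f` read backwards, given by
equations in the `l_i`. -/
theorem definableFun_symm {f : M ≃ (Fin n → M)} (hf : ∀ x i, f x i = op i x) :
    (univ : Set M).DefinableFun (unaryLang n) fun y : Fin n → M => f.symm y := by
  have h : (univ : Set M).Definable (unaryLang n)
      {v : Option (Fin n) → M | ∀ i, v (some i) = op i (v none)} := by
    rw [Set.ofPred_forall]
    exact definable_iInter_of_finite fun i =>
      (DefinableFun.proj _).ofPred_eq (definableFun_op i none)
  rw [DefinableFun]
  convert! h using 1
  ext v
  simp only [tupleGraph, Set.mem_ofPred_eq, Equiv.symm_apply_eq, funext_iff, hf,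
    Function.comp_apply]

theorem definableFun_eval {f : M ≃ (Fin n → M)} (hf : ∀ x i, f x i = op i x) {V ι : Type}
    [Finite ι] (g : V → ι) (t : Tree n (V ⊕ M)) : (univ : Set M).DefinableFun (unaryLang n)
      fun z : ι → M => t.eval f (Sum.elim (z ∘ g) id) := by
  induction t with
  | leaf a =>
    rcases a with v | c
    · exact DefinableFun.proj _
    · exact (unaryLang n).definableFun_const _ (mem_univ c)
  | node t ih =>
    exact DefinableFun.comp (g := fun (z : ι → M) i => (t i).eval f (Sum.elim (z ∘ g) id))
      ih (definableFun_symm hf)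

theorem definable_polyMap_graph {f : M ≃ (Fin n → M)} (hf : ∀ x i, f x i = op i x) {V ι : Type}
    [Finite ι] [Finite V] (σ : ι → Tree n (V ⊕ M)) : (univ : Set M).Definable (unaryLang n)
      {z : V ⊕ ι → M | z ∘ Sum.inr = polyMap f id σ (z ∘ Sum.inl)} := by
  have h : (univ : Set M).Definable (unaryLang n)
      {z : V ⊕ ι → M | ∀ i, z (Sum.inr i) = (σ i).eval f (Sum.elim (z ∘ Sum.inl) id)} := by
    rw [Set.ofPred_forall]
    exact definable_iInter_of_finite fun i =>
      (DefinableFun.proj _).ofPred_eq (definableFun_eval hf Sum.inl (σ i))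
  convert! h using 1
  ext z
  exact funext_iff

theorem IsCell.definable {f : M ≃ (Fin n → M)} (hf : ∀ x i, f x i = op i x) {d k : ℕ}
    {B : Set (Fin d → M)} (h : IsCell f k B) : (univ : Set M).Definable (unaryLang n) B := by
  obtain ⟨σ, -, rfl⟩ := h.exists_fin
  convert! ((definable_polyMap_graph hf σ).preimage_comp
    (Sum.swap : Fin k ⊕ Fin d → Fin d ⊕ Fin k)).exists_of_finite using 1
  ext x
  exact exists_congr fun z => eq_comm

/-- A cell of dimension `k` is in definable bijection with `M ^ k`. -/
theorem IsCell.cls_eq {f : M ≃ (Fin n → M)} (hf : ∀ x i, f x i = op i x) {d k : ℕ}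
    {B : Set (Fin d → M)} (h : IsCell f k B) (hB : (univ : Set M).Definable (unaryLang n) B) :
    K0.cls (⟨d, B, hB⟩ : DefSet (unaryLang n) M) =
      K0.cls (DefSet.pow (unaryLang n) M 1) ^ k := by
  rw [← cls_pow]
  obtain ⟨σ, hσ, rfl⟩ := h.exists_fin
  rw [K0.cls, K0.cls]
  congr 1
  refine (K0Semiring.mk_eq_mk _ _).2 (DefEquiv.symm ?_)
  let φ : Total (fun _ : Fin 1 => DefSet.pow (unaryLang n) M k) →
      Total (fun _ : Fin 1 => (⟨d, range (polyMap f id σ), hB⟩ : DefSet (unaryLang n) M)) :=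
    fun z => ⟨0, polyMap f id σ z.2.1, z.2.1, rfl⟩
  have hφ : Bijective φ := by
    constructor
    · rintro ⟨i, x, hx⟩ ⟨j, y, hy⟩ h
      obtain rfl : i = j := Subsingleton.elim _ _
      have h1 : polyMap f id σ x = polyMap f id σ y :=
        congrArg Subtype.val (eq_of_heq (Sigma.mk.inj h).2)
      obtain rfl := hσ h1
      rfl
    · rintro ⟨j, y, x, rfl⟩
      obtain rfl : j = 0 := Subsingleton.elim _ _
      exact ⟨⟨0, x, mem_univ x⟩, rfl⟩
  refine ⟨Equiv.ofBijective φ hφ, fun i j => ?_⟩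
  obtain rfl : j = (0 : Fin 1) := Subsingleton.elim (α := Fin 1) _ _
  convert! definable_polyMap_graph hf σ using 1
  ext z
  constructor
  · rintro ⟨hx, hy, h⟩
    exact (congrArg Subtype.val (eq_of_heq (Sigma.mk.inj h).2)).symm
  · intro h
    exact ⟨mem_univ _, ⟨_, h.symm⟩, congrArg (Sigma.mk 0) (Subtype.ext h.symm)⟩

/-- Cells contribute powers of `[M]`, and inclusion-exclusion stays in the subring. Definability is
carried along because the class cannot be formed without it. -/
theorem cls_mem_of_constructible [Nonempty M] {f : AcyclicPairing n M}
    (hf : ∀ x i, f.toEquiv x i = op i x) {A : Subring (K0 (unaryLang n) M)}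
    (hA : K0.cls (DefSet.pow (unaryLang n) M 1) ∈ A) {d : ℕ} {S : Set (Fin d → M)}
    (hS : Constructible f.toEquiv S) : ∃ h : (univ : Set M).Definable (unaryLang n) S,
      K0.cls (⟨d, S, h⟩ : DefSet (unaryLang n) M) ∈ A := by
  refine Constructible.induction (f := f)
    (P := fun S => ∃ h : (univ : Set M).Definable (unaryLang n) S,
      K0.cls (⟨d, S, h⟩ : DefSet (unaryLang n) M) ∈ A) ?_ ?_ ?_ hS
  · exact ⟨definable_empty, by rw [cls_empty]; exact zero_mem A⟩
  · intro D hD G hG hc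
    induction G, hG using Set.Finite.induction_on generalizing D with
    | empty =>
      rw [sUnion_empty, sdiff_empty]
      rcases hD with rfl | ⟨k, hD⟩
      · exact ⟨definable_empty, by rw [cls_empty]; exact zero_mem A⟩
      · exact ⟨hD.definable hf, by rw [hD.cls_eq hf]; exact pow_mem hA k⟩
    | @insert T G _ _ ih =>
      have hc' : ∀ C ∈ G, IsClosedSet f.toEquiv C := fun C hC => hc C (mem_insert_of_mem _ hC)
      obtain ⟨h1, m1⟩ := ih D hD hc'
      obtain ⟨h2, m2⟩ := ih _ (hD.inter (hc T (mem_insert _ _))) hc'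
      rw [sdiff_sUnion_insert]
      refine ⟨h1.sdiff h2, ?_⟩
      rw [cls_sdiff h1 h2 fun x hx => ⟨hx.1.1, hx.2⟩]
      exact sub_mem m1 m2
  · rintro S T - - hd ⟨h1, m1⟩ ⟨h2, m2⟩
    exact ⟨h1.union h2, by rw [cls_union h1 h2 hd]; exact add_mem m1 m2⟩

theorem subring_eq_top_of_cls_mem [Nonempty M] {f : AcyclicPairing n M}
    (hf : ∀ x i, f.toEquiv x i = op i x) {A : Subring (K0 (unaryLang n) M)}
    (hA : K0.cls (DefSet.pow (unaryLang n) M 1) ∈ A) : A = ⊤ :=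
  eq_top_of_cls_mem fun B =>
    (cls_mem_of_constructible hf hA (Definable.constructible f hf B.definable)).2

/-- One node over `n` distinct variables exhibits `M` as a cell of dimension `n`. -/
theorem cls_pow_one_pow {f : M ≃ (Fin n → M)} (hf : ∀ x i, f x i = op i x) :
    K0.cls (DefSet.pow (unaryLang n) M 1) ^ n = K0.cls (DefSet.pow (unaryLang n) M 1) := by
  have h : IsCell f n (univ : Set (Fin 1 → M)) := by
    refine ⟨Fin n, _, fun _ => .node fun i => .leaf (.inl i), Fintype.card_fin n, ?_, ?_⟩
    · intro z z' h
      exact f.symm.injective (congrFun h 0)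
    · refine eq_univ_of_forall fun x => ⟨f (x 0), funext fun c => ?_⟩
      obtain rfl : c = 0 := Subsingleton.elim _ _
      exact f.symm_apply_apply (x 0)
  exact (h.cls_eq hf definable_univ).symm

/-- Since `word` applies the head first, `t₀` accumulates the letters already applied. After one
letter the term is an application and never again a bare variable, as the acyclicity hypothesis
requires. -/
theorem exists_term_realize_eq_word {f : M ≃ (Fin n → M)} (hf : ∀ x i, f x i = op i x)
    (l : List (Fin n)) (t₀ : (unaryLang n).Term Unit) : ∃ t : (unaryLang n).Term Unit,
      (t₀ ≠ .var () → t ≠ .var ()) ∧ (l ≠ [] → t ≠ .var ()) ∧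
        ∀ x : M, t.realize (fun _ => x) = word f l (t₀.realize fun _ => x) := by
  induction l generalizing t₀ with
  | nil => exact ⟨t₀, id, fun h => absurd rfl h, fun x => rfl⟩
  | cons a l ih =>
    obtain ⟨t, ht, -, h⟩ := ih (Term.func (L := unaryLang n) (UnaryFunc.l a) ![t₀])
    have hne : t ≠ .var () := ht (by simp)
    refine ⟨t, fun _ => hne, fun _ => hne, fun x => (h x).trans ?_⟩
    simp only [word, hf, op, Term.realize]
    congr 2
    funext c
    obtain rfl : c = 0 := Subsingleton.elim _ _
    rfl

end CellClasses

end PairingK0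

/-! ### The isomorphism -/

open PairingK0 in
theorem mainTheorem2 (n : ℕ) (hn : 1 ≤ n) (M : Type*) [Nonempty M]
    [(PairingK0.unaryLang n).Structure M]
    (hbij : Function.Bijective (fun (x : M) (i : Fin n) => PairingK0.op i x))
    (hcyc : ∀ t : (PairingK0.unaryLang n).Term Unit, t ≠ FirstOrder.Language.Term.var () →
      ∀ x : M, t.realize (fun _ => x) ≠ x) :
    ∃ e : (Polynomial ℤ ⧸ Ideal.span {(Polynomial.X - Polynomial.X ^ n : Polynomial ℤ)}) ≃+*
        PairingK0.K0 (PairingK0.unaryLang n) M,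
      e (Ideal.Quotient.mk _ Polynomial.X) =
        PairingK0.K0.cls (PairingK0.DefSet.pow (PairingK0.unaryLang n) M 1) := by
  let g : M ≃ (Fin n → M) := Equiv.ofBijective _ hbij
  have hg : ∀ x i, g x i = op i x := fun _ _ => rfl
  let f : AcyclicPairing n M := ⟨g, hn, fun l hl x => by
    obtain ⟨t, -, ht, h⟩ := exists_term_realize_eq_word hg l (.var ())
    have h1 := h x
    rw [FirstOrder.Language.Term.realize] at h1
    rw [← h1]
    exact hcyc t (ht hl) x⟩
  let m := K0.cls (DefSet.pow (unaryLang n) M 1)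
  let I : Ideal (Polynomial ℤ) := Ideal.span {Polynomial.X - Polynomial.X ^ n}
  have hI : ∀ q ∈ I, (Polynomial.aeval m).toRingHom q = 0 := by
    intro q hq
    obtain ⟨p, rfl⟩ := Ideal.mem_span_singleton.1 hq
    have : m ^ n = m := cls_pow_one_pow hg
    simp [this]
  let φ : Polynomial ℤ ⧸ I →+* K0 (unaryLang n) M :=
    Ideal.Quotient.lift I (Polynomial.aeval m).toRingHom hI
  have hφ : ∀ q, φ (Ideal.Quotient.mk I q) = Polynomial.aeval m q := fun q => rfl
  have hr : (Ideal.Quotient.mk I Polynomial.X) ^ n = Ideal.Quotient.mk I Polynomial.X := by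
    rw [← map_pow]
    exact (Ideal.Quotient.eq.2 (Ideal.mem_span_singleton_self _)).symm
  -- Only additivity of the Euler characteristic is available, so the identity is checked on
  -- monomials, using `m ^ k = [M ^ k]`.
  have hleft : ∀ q : Polynomial ℤ,
      eulerK0 f hg hr (Polynomial.aeval m q) = Ideal.Quotient.mk I q := by
    intro q
    induction q using Polynomial.induction_on' with
    | add p q hp hq => rw [map_add, map_add, hp, hq, map_add]
    | monomial k c =>
      rw [← Polynomial.C_mul_X_pow_eq_monomial, ← Polynomial.smul_eq_C_mul, map_smul, map_pow,
        Polynomial.aeval_X, map_zsmul, ← cls_pow, eulerK0_pow, map_zsmul, map_pow]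
  refine ⟨RingEquiv.ofBijective φ ⟨fun x y hxy => ?_, fun x => ?_⟩, ?_⟩
  · obtain ⟨p, rfl⟩ := Ideal.Quotient.mk_surjective x
    obtain ⟨q, rfl⟩ := Ideal.Quotient.mk_surjective y
    rw [← hleft p, ← hleft q, ← hφ, ← hφ, hxy]
  · have h := subring_eq_top_of_cls_mem (f := f) hg (A := φ.range)
      ⟨Ideal.Quotient.mk I Polynomial.X, (hφ _).trans (Polynomial.aeval_X m)⟩
    have hx : x ∈ φ.range := h ▸ Subring.mem_top x
    exact hx
  · exact (hφ _).trans (Polynomial.aeval_X m)
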